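/- Let $(G_i)_{i\ge 0}$ be i.i.d. standard complex Gaussian random variables (density $\pi^{-1}e^{-|z|^2}$ on $\mathbb{C}$), and for $n\ge 0$ let $Z_1,\dots,Z_{N}$ be the roots, listed with multiplicity, of the Kac polynomial $P_n(z)=\sum_{i=0}^n G_i z^i$ (almost surely $N=n$). For $k\ge 0$, the $k$-point correlation function of these roots is the function $\rho_k^{(n)}:\mathbb{C}^k\to[0,\infty)$, $$\rho_k^{(n)}(z_1,\dots,z_k)=\mathbb{E}\Big[\sum_{i_1,\dots,i_k\ \text{pairwise distinct}}\ \prod_{\ell=1}^k\delta_0(Z_{i_\ell}-z_\ell)\Big],$$ i.e. the continuous function such that $\mathbb{E}\sum_{i_1,\dots,i_k\text{ pairwise distinct}}\varphi(Z_{i_1},\dots,Z_{i_k})=\int_{\mathbb{C}^k}\varphi\,\rho_k^{(n)}$ (integral with respect to Lebesgue measure) for every measurable $\varphi\ge 0$; such a function exists and is unique for all $n,k$. Then for every $k\ge 0$ and every real $y<1$, writing $\mathbb{D}(y)=\{z\in\mathbb{C}:|z|\le y\}$, $$\rho_k^{(n)}\longrightarrow\rho_k^{(\infty)}\qquad (n\to\infty)\quad\text{uniformly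 on }\mathbb{D}(y)^k,$$ where, at pairwise distinct points $z_1,\dots,z_k$ of the open unit disc, $$\rho_k^{(\infty)}(z_1,\dots,z_k)=\frac{\operatorname{per}\big(C-BA^{-1}B^*\big)}{\det(\pi A)},$$ and $\rho_k^{(\infty)}(z_1,\dots,z_k)=0$ if two of the points coincide. Here $A,B,C$ are the $k\times k$ matrices $$A_{ij}=h_\infty(z_i\overline{z_j}),\qquad B_{ij}=\overline{z_j}\,g_\infty(z_i\overline{z_j}),\qquad C_{ij}=g_\infty(z_i\overline{z_j})+z_i\overline{z_j}\,f_\infty(z_i\overline{z_j}),$$ with $h_\infty(z)=\frac1{1-z}$, $g_\infty(z)=h_\infty'(z)=\frac1{(1-z)^2}$, $f_\infty(z)=h_\infty''(z)=\frac2{(1-z)^3}$. -/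

import Mathlib

open MeasureTheory ProbabilityTheory Filter Topology
open scoped ENNReal ComplexConjugate

noncomputable section

/-- The standard complex Gaussian law on `ℂ` (mean `0`, `E|G|² = 1`), with density
`exp (-|z|²) / π` with respect to Lebesgue measure. -/
def stdComplexGaussian : Measure ℂ :=
  (volume : Measure ℂ).withDensity
    (fun z => ENNReal.ofReal (Real.exp (-‖z‖ ^ 2) / Real.pi))

/-- The polynomial `∑_{i=0}^n a_i X^i`. -/
def kacPolynomial (n : ℕ) (a : ℕ → ℂ) : Polynomial ℂ :=
  ∑ i ∈ Finset.range (n + 1), Polynomial.C (a i) * Polynomial.X ^ i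

/-- `∑ φ (Z_{i_1}, …, Z_{i_k})`, the sum being over all `k`-tuples of pairwise distinct indices
of the finite family `Z` of the elements of the multiset `s`, listed with multiplicity. -/
def sumDistinct (k : ℕ) (s : Multiset ℂ) (φ : (Fin k → ℂ) → ℝ≥0∞) : ℝ≥0∞ :=
  ∑ e : Fin k ↪ s.ToType, φ (fun j => (e j).1)

/-- `ρ` is the (continuous version of the) `k`-point correlation function, with respect to
Lebesgue measure, of the random finite multiset `Z` of complex numbers:
`E ∑_{i_1, …, i_k pairwise distinct} φ (Z_{i_1}, …, Z_{i_k}) = ∫ φ ρ` for every measurable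
`φ ≥ 0`. This says that `ρ(z) = E ∑ ∏_l δ_0 (Z_{i_l} - z_l)`. -/
structure IsCorrelationFunction {Ω : Type*} [MeasurableSpace Ω] (P : Measure Ω)
    (Z : Ω → Multiset ℂ) (k : ℕ) (ρ : (Fin k → ℂ) → ℝ) : Prop where
  continuous : Continuous ρ
  nonneg : ∀ z, 0 ≤ ρ z
  lintegral_eq : ∀ φ : (Fin k → ℂ) → ℝ≥0∞, Measurable φ →
    ∫⁻ ω, sumDistinct k (Z ω) φ ∂P = ∫⁻ z, φ z * ENNReal.ofReal (ρ z)

/-- `h_∞(z) = 1 / (1 - z)`. -/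
def hInf (z : ℂ) : ℂ := 1 / (1 - z)

/-- `g_∞(z) = 1 / (1 - z)²`, the derivative of `h_∞`. -/
def gInf (z : ℂ) : ℂ := 1 / (1 - z) ^ 2

/-- `f_∞(z) = 2 / (1 - z)³`, the second derivative of `h_∞`. -/
def fInf (z : ℂ) : ℂ := 2 / (1 - z) ^ 3

/-- `lim E[P(z_i) conj P(z_j)]`. -/
def covA {k : ℕ} (z : Fin k → ℂ) : Matrix (Fin k) (Fin k) ℂ :=
  Matrix.of fun i j => hInf (z i * conj (z j))

/-- `lim E[P'(z_i) conj P(z_j)]`. -/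
def covB {k : ℕ} (z : Fin k → ℂ) : Matrix (Fin k) (Fin k) ℂ :=
  Matrix.of fun i j => conj (z j) * gInf (z i * conj (z j))

/-- `lim E[P'(z_i) conj P'(z_j)]`, that is, `(x h_∞'(x))'` at `x = z_i conj z_j`. -/
def covC {k : ℕ} (z : Fin k → ℂ) : Matrix (Fin k) (Fin k) ℂ :=
  Matrix.of fun i j =>
    gInf (z i * conj (z j)) + z i * conj (z j) * fInf (z i * conj (z j))

open Classical in
/-- The limiting correlation function `per (C - B A⁻¹ B*) / det (π A)` at pairwise distinct
points, and `0` if two of the points coincide (there the quotient reads `0 / 0`). -/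
def rhoInf (k : ℕ) (z : Fin k → ℂ) : ℂ :=
  if Function.Injective z then
    (covC z - covB z * (covA z)⁻¹ * (covB z).conjTranspose).permanent /
      ((Real.pi : ℂ) • covA z).det
  else 0

end

/-!
Fix the zeros `z = (z_1, …, z_k)` and all but the first `k` coefficients, `t`; then the first `k`
coefficients are determined by a Vandermonde system. The resulting map `(z, t) ↦ a` is
block-triangular with real Jacobian determinant `∏ |P'(z_i)|² / |Vandermonde|²`, so the area formula
turns the sum over tuples of zeros into a Gaussian integral over the coefficient vectors in the
kernel of the Vandermonde matrix. Wick's formula, by which Gaussian moments are permanents,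
evaluates it as `per (C - B A⁻¹ B*) / det (π A)`, where `A`, `B`, `C` are the Gram matrices of the
rows `(1, z_i, …, z_i ^ n)` and of their derivatives.

This quotient degenerates when points collide. Newton interpolation writes the two families of rows
as `E = Λ W` and `D = Λ' W + Δ Q`, where `W` and `Q` consist of divided differences and `Δ` is the
diagonal matrix of the `∏_{l ≠ i} (z_i - z_l)`. Subtracting a multiple of `E` from `D` does not
change the conditional covariance, and `|det Λ|² = |det Δ|`; hence the intensity is `|det Δ|` times
the same expression in `W` and `Q`. The latter is regular everywhere, since `W` contains a
unitriangular block. Its entries are partial sums dominated by a geometric series as long as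
`|z_i| ≤ y < 1`, so that the intensities converge uniformly, and the factor `|det Δ|` makes the
limit vanish when two points coincide.
-/

section AreaFormula

variable {E : Type*} [NormedAddCommGroup E] [NormedSpace ℝ E] [FiniteDimensional ℝ E]

theorem exists_forall_approximatesLinearOn_injOn {A : E →L[ℝ] E} (hA : A.det ≠ 0) :
    ∃ c : NNReal, c ≠ 0 ∧ ∀ (f : E → E) (t : Set E),
      ApproximatesLinearOn f A t c → Set.InjOn f t := by
  set B := A.toContinuousLinearEquivOfDetNeZero hA
  rcases B.subsingleton_or_nnnorm_symm_pos with hE | hB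
  · exact ⟨1, one_ne_zero,
      fun f t _ => Set.injOn_of_injective (Function.injective_of_subsingleton f)⟩
  · refine ⟨‖(B.symm : E →L[ℝ] E)‖₊⁻¹ / 2, div_ne_zero (inv_ne_zero hB.ne') two_ne_zero,
      fun f t h => ?_⟩
    exact ApproximatesLinearOn.injOn (f' := B) h
      (Or.inr (NNReal.half_lt_self (inv_ne_zero hB.ne')))

variable [MeasurableSpace E] [BorelSpace E] {f : E → E} {f' : E → E →L[ℝ] E} {s : Set E}
  {g : E → ℝ≥0∞}

theorem exists_partition_injOn (hs : MeasurableSet s)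
    (hf : ∀ x ∈ s, HasFDerivWithinAt f (f' x) s x) (hdet : Measurable fun x => (f' x).det) :
    ∃ t : ℕ → Set E, Pairwise (Function.onFun Disjoint t) ∧ (∀ n, MeasurableSet (t n)) ∧
      (⋃ n, t n) = {x ∈ s | (f' x).det ≠ 0} ∧ ∀ n, Set.InjOn f (t n) := by
  set r : Set E := {x ∈ s | (f' x).det ≠ 0}
  have hrm : MeasurableSet r := hs.inter (hdet (measurableSet_singleton 0).compl)
  choose! c hc0 hc using fun A : E →L[ℝ] E => exists_forall_approximatesLinearOn_injOn (A := A)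
  obtain ⟨t, A, hdisj, hmeas, hcover, happrox, hA⟩ :=
    exists_partition_approximatesLinearOn_of_hasFDerivWithinAt f r f'
      (fun x hx => (hf x hx.1).mono (Set.sep_subset s _))
      (fun A => if A.det = 0 then 1 else c A) (fun A => by
        split_ifs with h
        exacts [one_ne_zero, hc0 A h])
  refine ⟨fun n => r ∩ t n, fun i j hij => (hdisj hij).mono Set.inter_subset_right
    Set.inter_subset_right, fun n => hrm.inter (hmeas n), ?_, fun n => ?_⟩
  · rw [← Set.inter_iUnion, Set.inter_eq_left.2 hcover]
  · rcases r.eq_empty_or_nonempty with h | h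
    · simp [h]
    · obtain ⟨y, hy, hAy⟩ := hA h n
      have hdet : (A n).det ≠ 0 := hAy ▸ hy.2
      have := happrox n
      rw [if_neg hdet] at this
      exact hc _ hdet _ _ this

theorem tsum_preimage_iUnion {α β : Type*} {t : ℕ → Set α}
    (ht : Pairwise (Function.onFun Disjoint t)) (f : α → β) (g : α → ℝ≥0∞) (b : β) :
    ∑' x : ↥((⋃ n, t n) ∩ f ⁻¹' {b}), g x = ∑' n, ∑' x : ↥(t n ∩ f ⁻¹' {b}), g x := by
  rw [Set.iUnion_inter]
  exact ENNReal.tsum_biUnion fun i _ j _ hij =>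
    (ht hij).mono Set.inter_subset_left Set.inter_subset_left

theorem tsum_preimage_of_injOn {α β : Type*} {f : α → β} {t : Set α} (hf : Set.InjOn f t)
    (g : α → ℝ≥0∞) (b : β) :
    ∑' x : ↥(t ∩ f ⁻¹' {b}), g x = Function.extend (t.domRestrict f) (fun x => g x) 0 b := by
  by_cases hb : b ∈ f '' t
  · obtain ⟨x, hx, rfl⟩ := hb
    have h : t ∩ f ⁻¹' {f x} = {x} :=
      Set.eq_singleton_iff_unique_mem.2 ⟨⟨hx, rfl⟩, fun y hy => hf hy.1 hx hy.2⟩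
    rw [h, tsum_singleton]
    exact (hf.injective.extend_apply (fun x : t => g x) 0 ⟨x, hx⟩).symm
  · have h : t ∩ f ⁻¹' {b} = ∅ :=
      Set.eq_empty_of_forall_notMem fun x hx => hb ⟨x, hx⟩
    rw [h, tsum_empty, Function.extend_apply' _ _ _ (by rintro ⟨x, rfl⟩; exact hb ⟨x, x.2, rfl⟩),
      Pi.zero_apply]

theorem measurable_tsum_preimage_of_injOn (hs : MeasurableSet s) (hf : ContinuousOn f s)
    (hinj : Set.InjOn f s) (hg : Measurable g) :
    Measurable fun a => ∑' x : ↥(s ∩ f ⁻¹' {a}), g x := by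
  simp_rw [tsum_preimage_of_injOn hinj]
  exact (hf.measurableEmbedding hs hinj).measurable_extend (hg.comp measurable_subtype_coe)
    measurable_zero

variable (μ : Measure E) [μ.IsAddHaarMeasure]

theorem lintegral_tsum_preimage_of_injOn (hs : MeasurableSet s)
    (hf : ∀ x ∈ s, HasFDerivWithinAt f (f' x) s x) (hinj : Set.InjOn f s) :
    ∫⁻ a, ∑' x : ↥(s ∩ f ⁻¹' {a}), g x ∂μ = ∫⁻ x in s, ENNReal.ofReal |(f' x).det| * g x ∂μ := by
  simp_rw [tsum_preimage_of_injOn hinj]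
  have hsupp : Function.support (Function.extend (s.domRestrict f) (fun x => g x) 0) ⊆ f '' s := by
    intro a ha
    by_contra h
    exact ha (Function.extend_apply' _ _ _ fun ⟨x, hx⟩ => h ⟨x, x.2, hx⟩)
  rw [← setLIntegral_eq_of_support_subset hsupp,
    lintegral_image_eq_lintegral_abs_det_fderiv_mul μ hs hf hinj]
  refine setLIntegral_congr_fun hs fun x hx => ?_
  rw [← hinj.injective.extend_apply (fun x : s => g x) 0 ⟨x, hx⟩]
  rfl

theorem ae_forall_det_ne_zero (hf : ∀ x ∈ s, HasFDerivWithinAt f (f' x) s x) :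
    ∀ᵐ a ∂μ, ∀ x ∈ s, f x = a → (f' x).det ≠ 0 := by
  have hnull : μ (f '' {x ∈ s | (f' x).det = 0}) = 0 :=
    addHaar_image_eq_zero_of_det_fderivWithin_eq_zero μ
      (fun x hx => (hf x hx.1).mono (Set.sep_subset s _)) fun x hx => hx.2
  filter_upwards [measure_eq_zero_iff_ae_notMem.1 hnull] with a ha x hxs hxa h0
  exact ha ⟨x, ⟨hxs, h0⟩, hxa⟩

theorem ae_tsum_preimage_eq_regular (hf : ∀ x ∈ s, HasFDerivWithinAt f (f' x) s x)
    (g : E → ℝ≥0∞) :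
    ∀ᵐ a ∂μ, ∑' x : ↥(s ∩ f ⁻¹' {a}), g x =
      ∑' x : ↥({x ∈ s | (f' x).det ≠ 0} ∩ f ⁻¹' {a}), g x := by
  filter_upwards [ae_forall_det_ne_zero μ hf] with a ha
  have h : s ∩ f ⁻¹' {a} = {x ∈ s | (f' x).det ≠ 0} ∩ f ⁻¹' {a} :=
    Set.Subset.antisymm (fun x hx => ⟨⟨hx.1, ha x hx.1 hx.2⟩, hx.2⟩) fun x hx => ⟨hx.1.1, hx.2⟩
  rw [h]

theorem aemeasurable_tsum_preimage (hs : MeasurableSet s)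
    (hf : ∀ x ∈ s, HasFDerivWithinAt f (f' x) s x) (hdet : Measurable fun x => (f' x).det)
    (hg : Measurable g) :
    AEMeasurable (fun a => ∑' x : ↥(s ∩ f ⁻¹' {a}), g x) μ := by
  obtain ⟨t, hdisj, hmeas, hunion, hinj⟩ := exists_partition_injOn hs hf hdet
  have hts : ∀ n, t n ⊆ s := fun n x hx => (hunion ▸ Set.mem_iUnion_of_mem n hx :).1
  have hcont : ContinuousOn f s := fun x hx => (hf x hx).continuousWithinAt
  have hsum : Measurable fun a => ∑' n, ∑' x : ↥(t n ∩ f ⁻¹' {a}), g x := Measurable.tsum fun n =>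
    measurable_tsum_preimage_of_injOn (hmeas n) (hcont.mono (hts n)) (hinj n) hg
  refine hsum.aemeasurable.congr ?_
  filter_upwards [ae_tsum_preimage_eq_regular μ hf g] with a ha
  rw [ha, ← hunion, tsum_preimage_iUnion hdisj]

/-- By Sard's theorem the critical points contribute to neither side. -/
theorem lintegral_tsum_preimage (hs : MeasurableSet s)
    (hf : ∀ x ∈ s, HasFDerivWithinAt f (f' x) s x) (hdet : Measurable fun x => (f' x).det)
    (hg : Measurable g) :
    ∫⁻ a, ∑' x : ↥(s ∩ f ⁻¹' {a}), g x ∂μ = ∫⁻ x in s, ENNReal.ofReal |(f' x).det| * g x ∂μ := by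
  obtain ⟨t, hdisj, hmeas, hunion, hinj⟩ := exists_partition_injOn hs hf hdet
  have hts : ∀ n, t n ⊆ s := fun n x hx => (hunion ▸ Set.mem_iUnion_of_mem n hx :).1
  have hcont : ContinuousOn f s := fun x hx => (hf x hx).continuousWithinAt
  calc ∫⁻ a, ∑' x : ↥(s ∩ f ⁻¹' {a}), g x ∂μ
      = ∫⁻ a, ∑' n, ∑' x : ↥(t n ∩ f ⁻¹' {a}), g x ∂μ := by
        refine lintegral_congr_ae ?_
        filter_upwards [ae_tsum_preimage_eq_regular μ hf g] with a ha
        rw [ha, ← hunion, tsum_preimage_iUnion hdisj]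
    _ = ∑' n, ∫⁻ x in t n, ENNReal.ofReal |(f' x).det| * g x ∂μ := by
        rw [lintegral_tsum fun n => (measurable_tsum_preimage_of_injOn (hmeas n)
          (hcont.mono (hts n)) (hinj n) hg).aemeasurable]
        exact tsum_congr fun n => lintegral_tsum_preimage_of_injOn μ (hmeas n)
          (fun x hx => (hf x (hts n hx)).mono (hts n)) (hinj n)
    _ = ∫⁻ x in {x | (f' x).det ≠ 0} ∩ s, ENNReal.ofReal |(f' x).det| * g x ∂μ := by
        rw [← lintegral_iUnion hmeas hdisj, hunion, Set.inter_comm]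
        rfl
    _ = ∫⁻ x in s, ENNReal.ofReal |(f' x).det| * g x ∂μ := by
        have hreg : MeasurableSet {x | (f' x).det ≠ 0} := hdet (measurableSet_singleton 0).compl
        rw [← Measure.restrict_restrict hreg]
        refine setLIntegral_eq_of_support_subset fun x hx h0 => hx ?_
        simp [h0]

end AreaFormula

section StandardGaussian

variable {ι : Type*} [Fintype ι]

/-- The density `π^{-|ι|} exp (-|a|²)` of the standard Gaussian vector in `ι → ℂ`. -/
noncomputable def stdGaussianPDF (a : ι → ℂ) : ℝ≥0∞ :=
  ENNReal.ofReal (Real.exp (-∑ i, ‖a i‖ ^ 2) / Real.pi ^ Fintype.card ι)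

theorem measurable_stdGaussianPDF : Measurable (stdGaussianPDF : (ι → ℂ) → ℝ≥0∞) := by
  unfold stdGaussianPDF
  fun_prop

theorem stdGaussianPDF_ne_top (a : ι → ℂ) : stdGaussianPDF a ≠ ∞ := ENNReal.ofReal_ne_top

theorem stdGaussianPDF_eq_prod (a : ι → ℂ) :
    stdGaussianPDF a = ∏ i, ENNReal.ofReal (Real.exp (-‖a i‖ ^ 2) / Real.pi) := by
  rw [← ENNReal.ofReal_prod_of_nonneg fun i _ => by positivity, Finset.prod_div_distrib,
    ← Real.exp_sum, Finset.sum_neg_distrib, Finset.prod_const, Finset.card_univ]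
  rfl

theorem lintegral_ofReal_prod {X : ι → Type*} [∀ i, MeasurableSpace (X i)]
    {μ : ∀ i, Measure (X i)} [∀ i, SigmaFinite (μ i)] {f : ∀ i, X i → ℝ}
    (hf : ∀ i, Integrable (f i) (μ i)) (hf0 : ∀ i x, 0 ≤ f i x) :
    ∫⁻ x, ∏ i, ENNReal.ofReal (f i (x i)) ∂Measure.pi μ =
      ∏ i, ∫⁻ x, ENNReal.ofReal (f i x) ∂μ i := by
  simp_rw [← fun i => ofReal_integral_eq_lintegral_ofReal (hf i) (ae_of_all _ (hf0 i)),
    ← ENNReal.ofReal_prod_of_nonneg fun i _ => integral_nonneg (hf0 i),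
    ← integral_fintype_prod_eq_prod, ofReal_integral_eq_lintegral_ofReal
      (Integrable.fintype_prod_dep hf) (ae_of_all _ fun x => Finset.prod_nonneg fun i _ =>
        hf0 i (x i)), ENNReal.ofReal_prod_of_nonneg fun i _ => hf0 i _]

theorem integrable_exp_neg_norm_sq_div_pi :
    Integrable fun z : ℂ => Real.exp (-‖z‖ ^ 2) / Real.pi := by
  refine Integrable.div_const ?_ _
  by_contra h
  have hint := Complex.integral_exp_neg_rpow one_le_two
  simp only [Real.rpow_two, integral_undef h] at hint
  norm_num [Real.pi_ne_zero.symm] at hint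

instance : SigmaFinite stdComplexGaussian := by
  unfold stdComplexGaussian
  infer_instance

theorem pi_stdComplexGaussian :
    Measure.pi (fun _ : ι => stdComplexGaussian) =
      (volume : Measure (ι → ℂ)).withDensity stdGaussianPDF := by
  refine Measure.pi_eq fun s hs => ?_
  set d : ℂ → ℝ := fun z => Real.exp (-‖z‖ ^ 2) / Real.pi
  have hd (z : ℂ) : 0 ≤ d z := by positivity
  have hind (a : ι → ℂ) : (Set.univ.pi s).indicator stdGaussianPDF a =
      ∏ i, ENNReal.ofReal ((s i).indicator d (a i)) := by
    by_cases ha : a ∈ Set.univ.pi s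
    · rw [Set.indicator_of_mem ha, stdGaussianPDF_eq_prod]
      exact Finset.prod_congr rfl fun i _ => by rw [Set.indicator_of_mem (ha i (Set.mem_univ i))]
    · obtain ⟨i, hi⟩ : ∃ i, a i ∉ s i := by simpa [Set.mem_pi] using ha
      rw [Set.indicator_of_notMem ha, Finset.prod_eq_zero (Finset.mem_univ i)]
      rw [Set.indicator_of_notMem hi, ENNReal.ofReal_zero]
  rw [withDensity_apply _ (MeasurableSet.univ_pi hs),
    ← lintegral_indicator (MeasurableSet.univ_pi hs)]
  simp_rw [hind]
  rw [volume_pi, lintegral_ofReal_prod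
    (fun i => integrable_exp_neg_norm_sq_div_pi.indicator (hs i))
    fun i => Set.indicator_nonneg fun z _ => hd z]
  refine Finset.prod_congr rfl fun i _ => ?_
  rw [stdComplexGaussian, withDensity_apply _ (hs i), ← lintegral_indicator (hs i)]
  exact lintegral_congr fun z =>
    congrFun (Set.indicator_comp_of_zero (g := ENNReal.ofReal) ENNReal.ofReal_zero).symm z

theorem integral_stdComplexGaussian {E : Type*} [NormedAddCommGroup E] [NormedSpace ℝ E]
    (f : ℂ → E) :
    ∫ z, f z ∂stdComplexGaussian = ∫ z, (Real.exp (-‖z‖ ^ 2) / Real.pi) • f z := by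
  rw [stdComplexGaussian, integral_withDensity_eq_integral_toReal_smul (by fun_prop)
    (Eventually.of_forall fun _ => ENNReal.ofReal_lt_top)]
  exact integral_congr_ae (Eventually.of_forall fun z =>
    congrArg (· • f z) (ENNReal.toReal_ofReal (by positivity)))

theorem integral_norm_pow_stdComplexGaussian (p : ℕ) :
    ∫ z, ‖z‖ ^ p ∂stdComplexGaussian = Real.Gamma (p / 2 + 1) := by
  have hpolar := Complex.integral_rpow_mul_exp_neg_rpow (p := 2) (q := p) one_le_two
    (by linarith [(Nat.cast_nonneg p : (0 : ℝ) ≤ p)])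
  simp only [Real.rpow_natCast, Real.rpow_two] at hpolar
  have hcomm (z : ℂ) : (Real.exp (-‖z‖ ^ 2) / Real.pi) • ‖z‖ ^ p =
      Real.pi⁻¹ * (‖z‖ ^ p * Real.exp (-‖z‖ ^ 2)) := by
    rw [smul_eq_mul]
    ring
  simp_rw [integral_stdComplexGaussian, hcomm, integral_const_mul, hpolar]
  field_simp

theorem integrable_norm_pow_stdComplexGaussian (p : ℕ) :
    Integrable (fun z : ℂ => ‖z‖ ^ p) stdComplexGaussian := by
  by_contra h
  refine (Real.Gamma_pos_of_pos (by positivity : (0 : ℝ) < p / 2 + 1)).ne ?_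
  rw [← integral_norm_pow_stdComplexGaussian, integral_undef h]

theorem integrable_pow_mul_conj_pow (p q : ℕ) :
    Integrable (fun z : ℂ => z ^ p * conj z ^ q) stdComplexGaussian := by
  refine (integrable_norm_pow_stdComplexGaussian (p + q)).mono'
    (by fun_prop) (Eventually.of_forall fun z => ?_)
  simp [pow_add]

theorem integral_pow_mul_conj_pow_self (p : ℕ) :
    ∫ z, z ^ p * conj z ^ p ∂stdComplexGaussian = p.factorial := by
  have hnorm (z : ℂ) : z ^ p * conj z ^ p = ((‖z‖ ^ (2 * p) : ℝ) : ℂ) := by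
    rw [← mul_pow, Complex.mul_conj, Complex.normSq_eq_norm_sq, pow_mul]
    push_cast
    rfl
  simp_rw [hnorm]
  rw [integral_complex_ofReal, integral_norm_pow_stdComplexGaussian, Nat.cast_mul, Nat.cast_two,
    mul_div_cancel_left₀ _ two_ne_zero, Real.Gamma_nat_eq_factorial, Complex.ofReal_natCast]

theorem integral_pow_mul_conj_pow_of_ne {p q : ℕ} (hpq : p ≠ q) :
    ∫ z, z ^ p * conj z ^ q ∂stdComplexGaussian = 0 := by
  have hpq' : (p : ℂ) - q ≠ 0 := sub_ne_zero.2 (by exact_mod_cast hpq)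
  -- the rotation by the angle `π / (p - q)` changes the sign of the integrand
  set c : Circle := Circle.exp (Real.pi / (p - q)) with hc
  have hcpq : (c : ℂ) ^ p * conj (c : ℂ) ^ q = -1 := by
    rw [hc, Circle.coe_exp, ← Complex.exp_conj, ← Complex.exp_nat_mul, ← Complex.exp_nat_mul,
      ← Complex.exp_add, ← Complex.exp_pi_mul_I]
    congr 1
    push_cast
    simp only [map_mul, Complex.conj_ofReal, Complex.conj_I, map_div₀, map_sub, map_natCast]
    field_simp
    ring
  have hrot := (rotation c).measurePreserving.integral_comp
    (rotation c).toHomeomorph.measurableEmbedding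
    (fun z => (Real.exp (-‖z‖ ^ 2) / Real.pi) • (z ^ p * conj z ^ q))
  have hneg (z : ℂ) : (Real.exp (-‖rotation c z‖ ^ 2) / Real.pi) •
      (rotation c z ^ p * conj (rotation c z) ^ q) =
      -((Real.exp (-‖z‖ ^ 2) / Real.pi) • (z ^ p * conj z ^ q)) := by
    rw [LinearIsometryEquiv.norm_map, rotation_apply, map_mul, mul_pow, mul_pow, ← smul_neg]
    congr 1
    linear_combination (z ^ p * conj z ^ q) * hcpq
  simp_rw [hneg, integral_neg] at hrot
  rw [integral_stdComplexGaussian]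
  exact self_eq_neg.1 hrot.symm

end StandardGaussian

section Wick

variable {κ ι : Type*} [Fintype κ] [Fintype ι]

theorem card_perm_comp_eq [DecidableEq κ] [DecidableEq ι] (f g : κ → ι) :
    Fintype.card {σ : Equiv.Perm κ // f ∘ σ = g} =
      ∏ l, if Fintype.card {i // f i = l} = Fintype.card {i // g i = l}
        then (Fintype.card {i // f i = l}).factorial else 0 := by
  by_cases h : ∀ l, Fintype.card {i // f i = l} = Fintype.card {i // g i = l}
  · let σ₀ : Equiv.Perm κ := Equiv.ofFiberEquiv fun l => Fintype.equivOfCardEq (h l).symm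
    have hσ₀ : f ∘ σ₀ = g := funext fun i => Equiv.ofFiberEquiv_map _ i
    have e : {σ : Equiv.Perm κ // f ∘ σ = g} ≃ {τ : Equiv.Perm κ // f ∘ τ = f} :=
      (Equiv.mulRight σ₀⁻¹).subtypeEquiv fun σ => by
        rw [← hσ₀, Equiv.coe_mulRight, Equiv.Perm.coe_mul, ← Function.comp_assoc]
        exact (Equiv.comp_symm_eq σ₀ f (f ∘ σ)).symm
    simp only [Fintype.card_congr e, DomMulAct.stabilizer_card, h, if_true]
  · push Not at h
    obtain ⟨l, hl⟩ := h
    rw [Finset.prod_eq_zero (Finset.mem_univ l) (if_neg hl), Fintype.card_eq_zero_iff]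
    refine ⟨fun ⟨σ, hσ⟩ => hl (Fintype.card_congr (σ.subtypeEquiv fun i => ?_)).symm⟩
    rw [← hσ]
    rfl

theorem prod_comp_mul_prod_conj_comp [DecidableEq ι] (f g : κ → ι) (a : ι → ℂ) :
    (∏ i, a (f i)) * ∏ i, conj (a (g i)) =
      ∏ l, (a l ^ Fintype.card {i // f i = l} * conj (a l) ^ Fintype.card {i // g i = l}) := by
  rw [Finset.prod_mul_distrib, ← Fintype.prod_fiberwise' f a,
    ← Fintype.prod_fiberwise' g fun l => conj (a l)]
  simp

theorem integrable_prod_comp_mul_prod_conj_comp (f g : κ → ι) :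
    Integrable (fun a : ι → ℂ => (∏ i, a (f i)) * ∏ i, conj (a (g i)))
      (Measure.pi fun _ => stdComplexGaussian) := by
  classical
  simp_rw [prod_comp_mul_prod_conj_comp]
  exact Integrable.fintype_prod fun l => integrable_pow_mul_conj_pow _ _

theorem integral_prod_comp_mul_prod_conj_comp [DecidableEq κ] [DecidableEq ι] (f g : κ → ι) :
    ∫ a : ι → ℂ, (∏ i, a (f i)) * ∏ i, conj (a (g i)) ∂(Measure.pi fun _ => stdComplexGaussian) =
      (Fintype.card {σ : Equiv.Perm κ // f ∘ σ = g} : ℂ) := by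
  simp_rw [prod_comp_mul_prod_conj_comp]
  rw [integral_fintype_prod_eq_prod (f := fun l z => z ^ Fintype.card {i // f i = l} *
    conj z ^ Fintype.card {i // g i = l}), card_perm_comp_eq, Nat.cast_prod]
  refine Finset.prod_congr rfl fun l _ => ?_
  split_ifs with h
  · rw [← h, integral_pow_mul_conj_pow_self]
  · rw [integral_pow_mul_conj_pow_of_ne h, Nat.cast_zero]

theorem prod_mulVec_eq_sum [DecidableEq κ] (L : Matrix κ ι ℂ) (a : ι → ℂ) :
    ∏ i, L.mulVec a i = ∑ f : κ → ι, (∏ i, L i (f i)) * ∏ i, a (f i) := by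
  simp only [Matrix.mulVec, dotProduct, Finset.prod_univ_sum, Fintype.piFinset_univ,
    Finset.prod_mul_distrib]

theorem permanent_mul_conjTranspose [DecidableEq κ] (L : Matrix κ ι ℂ) :
    (L * L.conjTranspose).permanent =
      ∑ σ : Equiv.Perm κ, ∑ f : κ → ι, (∏ i, L i (f i)) * ∏ i, conj (L i (f (σ i))) := by
  refine Finset.sum_congr rfl fun σ _ => ?_
  simp only [Matrix.mul_apply, Matrix.conjTranspose_apply, Finset.prod_univ_sum,
    Fintype.piFinset_univ, Finset.prod_mul_distrib]
  refine Fintype.sum_equiv (σ.arrowCongr (Equiv.refl ι)) _ _ fun g => ?_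
  congr 1
  · simpa using Equiv.prod_comp σ fun j => L j (g (σ.symm j))
  · simp

theorem prod_norm_sq_mulVec_eq_sum [DecidableEq κ] (L : Matrix κ ι ℂ) (a : ι → ℂ) :
    ((∏ i, ‖L.mulVec a i‖ ^ 2 : ℝ) : ℂ) = ∑ f : κ → ι, ∑ g : κ → ι,
      ((∏ i, L i (f i)) * ∏ i, conj (L i (g i))) * ((∏ i, a (f i)) * ∏ i, conj (a (g i))) := by
  have hnorm (w : ℂ) : ((‖w‖ ^ 2 : ℝ) : ℂ) = w * conj w := by
    rw [Complex.mul_conj, Complex.normSq_eq_norm_sq]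
  simp_rw [Complex.ofReal_prod, hnorm, Finset.prod_mul_distrib, ← map_prod, prod_mulVec_eq_sum,
    map_sum, Finset.sum_mul_sum]
  refine Finset.sum_congr rfl fun f _ => Finset.sum_congr rfl fun g _ => ?_
  rw [map_mul]
  ring

theorem integrable_prod_norm_sq_mulVec (L : Matrix κ ι ℂ) :
    Integrable (fun a : ι → ℂ => ∏ i, ‖L.mulVec a i‖ ^ 2)
      (Measure.pi fun _ => stdComplexGaussian) := by
  classical
  suffices Integrable (fun a : ι → ℂ => ((∏ i, ‖L.mulVec a i‖ ^ 2 : ℝ) : ℂ))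
      (Measure.pi fun _ => stdComplexGaussian) from this.re
  simp_rw [prod_norm_sq_mulVec_eq_sum]
  exact integrable_finsetSum _ fun f _ => integrable_finsetSum _ fun g _ =>
    (integrable_prod_comp_mul_prod_conj_comp f g).const_mul _

/-- Wick's formula: only the pairings of each factor with a conjugate factor contribute. -/
theorem integral_prod_norm_sq_mulVec [DecidableEq κ] (L : Matrix κ ι ℂ) :
    ((∫ a : ι → ℂ, ∏ i, ‖L.mulVec a i‖ ^ 2 ∂(Measure.pi fun _ => stdComplexGaussian) : ℝ) : ℂ) =
      (L * L.conjTranspose).permanent := by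
  have hint (f g : κ → ι) := (integrable_prod_comp_mul_prod_conj_comp f g).const_mul
    ((∏ i, L i (f i)) * ∏ i, conj (L i (g i)))
  classical
  rw [← integral_complex_ofReal]
  simp_rw [prod_norm_sq_mulVec_eq_sum]
  rw [integral_finsetSum _ fun f _ => integrable_finsetSum _ fun g _ => hint f g,
    permanent_mul_conjTranspose, Finset.sum_comm]
  refine Finset.sum_congr rfl fun f _ => ?_
  rw [integral_finsetSum _ fun g _ => hint f g]
  simp_rw [integral_const_mul, integral_prod_comp_mul_prod_conj_comp, Fintype.card_subtype,
    ← Finset.sum_boole, Finset.mul_sum]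
  rw [Finset.sum_comm]
  exact Finset.sum_congr rfl fun σ _ => by simp

end Wick

section ComplexChangeOfVariables

open scoped Matrix

variable {ι : Type*} [Fintype ι] [DecidableEq ι]

/-- Multiplication by a complex matrix, as a continuous linear map over `ℝ`. -/
noncomputable def realMulVecCLM (M : Matrix ι ι ℂ) : (ι → ℂ) →L[ℝ] (ι → ℂ) :=
  LinearMap.toContinuousLinearMap ((Matrix.toLin' M).restrictScalars ℝ)

theorem det_realMulVecCLM (M : Matrix ι ι ℂ) : (realMulVecCLM M).det = ‖M.det‖ ^ 2 := by
  simp [realMulVecCLM, ContinuousLinearMap.det, LinearMap.det_restrictScalars,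
    Algebra.norm_complex_eq, Complex.normSq_eq_norm_sq]

theorem lintegral_comp_mulVec {M : Matrix ι ι ℂ} (hM : M.det ≠ 0) {f : (ι → ℂ) → ℝ≥0∞}
    (hf : Measurable f) :
    ∫⁻ x, f (M *ᵥ x) = ENNReal.ofReal (‖M.det‖ ^ 2)⁻¹ * ∫⁻ x, f x := by
  have hmap := Measure.map_linearMap_addHaar_eq_smul_addHaar (volume : Measure (ι → ℂ))
    (f := (realMulVecCLM M : (ι → ℂ) →ₗ[ℝ] (ι → ℂ)))
    ((det_realMulVecCLM M).trans_ne (by positivity))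
  rw [show LinearMap.det (realMulVecCLM M : (ι → ℂ) →ₗ[ℝ] (ι → ℂ)) = ‖M.det‖ ^ 2 from
    det_realMulVecCLM M, abs_of_nonneg (by positivity)] at hmap
  rw [← smul_eq_mul, ← lintegral_smul_measure, ← hmap]
  exact (lintegral_map hf (realMulVecCLM M).continuous.measurable).symm

end ComplexChangeOfVariables

section GaussianMatrices

open scoped Matrix ComplexOrder MatrixOrder

variable {κ ι μ : Type*} [Fintype κ] [Fintype ι] [Fintype μ]

theorem exists_conjTranspose_mul_self_eq {S : Matrix ι ι ℂ} (hS : S.PosSemidef) :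
    ∃ Y : Matrix ι ι ℂ, Yᴴ * Y = S := by
  classical
  obtain ⟨Y, hY⟩ := CStarAlgebra.nonneg_iff_eq_star_mul_self.1 hS.nonneg
  exact ⟨Y, hY.symm⟩

theorem permanent_nonneg [DecidableEq ι] {S : Matrix ι ι ℂ} (hS : S.PosSemidef) :
    0 ≤ S.permanent := by
  obtain ⟨Y, rfl⟩ := exists_conjTranspose_mul_self_eq hS
  have hwick := integral_prod_norm_sq_mulVec Yᴴ
  rw [Matrix.conjTranspose_conjTranspose] at hwick
  rw [← hwick]
  exact_mod_cast integral_nonneg fun a => by positivity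

theorem sum_norm_sq_mulVec (X : Matrix μ ι ℂ) (u : ι → ℂ) :
    ((∑ i, ‖(X *ᵥ u) i‖ ^ 2 : ℝ) : ℂ) = star u ⬝ᵥ (Xᴴ * X) *ᵥ u := by
  rw [← Matrix.mulVec_mulVec, Matrix.dotProduct_mulVec, Matrix.vecMul_conjTranspose, star_star,
    dotProduct, Complex.ofReal_sum]
  refine Finset.sum_congr rfl fun i _ => ?_
  rw [Pi.star_apply, Complex.star_def, mul_comm, Complex.mul_conj, Complex.normSq_eq_norm_sq]

theorem lintegral_prod_norm_sq_mulVec_mul_stdGaussianPDF [DecidableEq κ] (L : Matrix κ ι ℂ) :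
    ∫⁻ t, ENNReal.ofReal (∏ i, ‖(L *ᵥ t) i‖ ^ 2) * stdGaussianPDF t =
      ENNReal.ofReal (L * Lᴴ).permanent.re := by
  rw [← integral_prod_norm_sq_mulVec, Complex.ofReal_re, ofReal_integral_eq_lintegral_ofReal
    (integrable_prod_norm_sq_mulVec L) (ae_of_all _ fun a => by positivity),
    pi_stdComplexGaussian, lintegral_withDensity_eq_lintegral_mul _ measurable_stdGaussianPDF
      (by fun_prop)]
  simp only [Pi.mul_apply, mul_comm]

theorem lintegral_prod_norm_sq_mulVec_mul_exp [DecidableEq κ] [DecidableEq ι]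
    (X : Matrix μ ι ℂ) (L : Matrix κ ι ℂ) (hX : (Xᴴ * X).det ≠ 0) :
    ∫⁻ t, ENNReal.ofReal (∏ i, ‖(L *ᵥ t) i‖ ^ 2) *
        ENNReal.ofReal (Real.exp (-∑ i, ‖(X *ᵥ t) i‖ ^ 2) / Real.pi ^ Fintype.card ι) =
      ENNReal.ofReal ((L * (Xᴴ * X)⁻¹ * Lᴴ).permanent / (Xᴴ * X).det).re := by
  obtain ⟨Y, hY⟩ := exists_conjTranspose_mul_self_eq (Matrix.posSemidef_conjTranspose_mul_self X)
  rw [← hY] at hX ⊢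
  have hdet : (Yᴴ * Y).det = ((‖Y.det‖ ^ 2 : ℝ) : ℂ) := by
    rw [Matrix.det_mul, Matrix.det_conjTranspose, Complex.star_def, ← Complex.normSq_eq_norm_sq,
      Complex.normSq_eq_conj_mul_self]
  have hY0 : Y.det ≠ 0 := fun h => hX (by rw [Matrix.det_mul, h, mul_zero])
  have hYunit : IsUnit Y.det := hY0.isUnit
  have hsum (t : ι → ℂ) : ∑ i, ‖(X *ᵥ t) i‖ ^ 2 = ∑ i, ‖(Y *ᵥ t) i‖ ^ 2 := by
    have h := sum_norm_sq_mulVec X t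
    rw [← hY, ← sum_norm_sq_mulVec] at h
    exact_mod_cast h
  have hL (t : ι → ℂ) : L *ᵥ t = (L * Y⁻¹) *ᵥ (Y *ᵥ t) := by
    rw [Matrix.mulVec_mulVec, Matrix.mul_assoc, Matrix.nonsing_inv_mul _ hYunit, Matrix.mul_one]
  have hcov : L * Y⁻¹ * (L * Y⁻¹)ᴴ = L * (Yᴴ * Y)⁻¹ * Lᴴ := by
    rw [Matrix.mul_inv_rev, Matrix.conjTranspose_mul, Matrix.conjTranspose_nonsing_inv]
    simp only [Matrix.mul_assoc]
  simp_rw [hsum, hL]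
  change ∫⁻ t, _ * stdGaussianPDF (Y *ᵥ t) = _
  rw [lintegral_comp_mulVec hY0 (f := fun x => ENNReal.ofReal (∏ i, ‖((L * Y⁻¹) *ᵥ x) i‖ ^ 2) *
      stdGaussianPDF x) (Measurable.mul (by fun_prop) measurable_stdGaussianPDF),
    lintegral_prod_norm_sq_mulVec_mul_stdGaussianPDF, hcov, hdet, Complex.div_ofReal_re,
    ← ENNReal.ofReal_mul (by positivity), mul_comm, div_eq_mul_inv]

end GaussianMatrices

section ZeroIntensity

open scoped Matrix ComplexOrder MatrixOrder

variable {κ ι ν : Type*} [Fintype κ] [DecidableEq κ] [Fintype ι] [Fintype ν] [DecidableEq ν]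

/-- The conditional covariance of `Y` given `X`, for a centred Gaussian vector `(X, Y)` with
`E[X X*] = A`, `E[Y X*] = B` and `E[Y Y*] = C`. -/
noncomputable def condCov (A B C : Matrix κ κ ℂ) : Matrix κ κ ℂ := C - B * A⁻¹ * Bᴴ

/-- `E[∏ |Y_i|² ; X = 0]` for a centred complex Gaussian vector `(X, Y)` with `E[X X*] = A`,
`E[Y X*] = B` and `E[Y Y*] = C`: the permanent is the conditional moment, the determinant comes
from the density of `X` at `0`. -/
noncomputable def zeroIntensity (A B C : Matrix κ κ ℂ) : ℂ :=
  (condCov A B C).permanent / ((Real.pi : ℂ) • A).det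

/-- `zeroIntensity` of the vector `(X, Y) = (E a, D a)`, where `a` is a standard Gaussian vector. -/
noncomputable def gramZeroIntensity (E D : Matrix κ ι ℂ) : ℂ :=
  zeroIntensity (E * Eᴴ) (D * Eᴴ) (D * Dᴴ)

theorem det_mul_conjTranspose_self (M : Matrix κ κ ℂ) :
    (M * Mᴴ).det = ((‖M.det‖ ^ 2 : ℝ) : ℂ) := by
  rw [Matrix.det_mul, Matrix.det_conjTranspose, Complex.star_def, Complex.mul_conj,
    Complex.normSq_eq_norm_sq]

theorem posSemidef_condCov (E D : Matrix κ ι ℂ) (hE : (E * Eᴴ).det ≠ 0) :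
    (condCov (E * Eᴴ) (D * Eᴴ) (D * Dᴴ)).PosSemidef := by
  have hpos : (E * Eᴴ).PosDef :=
    (Matrix.posSemidef_self_mul_conjTranspose E).posDef_iff_det_ne_zero.2 hE
  have : Invertible (E * Eᴴ) := (E * Eᴴ).invertibleOfIsUnitDet hE.isUnit
  have hblocks := Matrix.posSemidef_self_mul_conjTranspose (Matrix.fromRows E D)
  rw [Matrix.conjTranspose_fromRows_eq_fromCols_conjTranspose, Matrix.fromRows_mul_fromCols,
    ← Matrix.conjTranspose_conjTranspose (D * Eᴴ)] at hblocks
  simpa [condCov] using (Matrix.PosDef.fromBlocks₁₁ (E * Dᴴ) (D * Dᴴ) hpos).1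
    (by simpa using hblocks)

theorem gramZeroIntensity_nonneg (E D : Matrix κ ι ℂ) (hE : (E * Eᴴ).det ≠ 0) :
    0 ≤ gramZeroIntensity E D := by
  refine div_nonneg (permanent_nonneg (posSemidef_condCov E D hE)) ?_
  rw [Matrix.det_smul]
  refine mul_nonneg (pow_nonneg (by exact_mod_cast Real.pi_pos.le) _) ?_
  exact (Matrix.posSemidef_self_mul_conjTranspose E).det_nonneg

theorem permanent_diagonal_mul_mul_diagonal (δ ε : κ → ℂ) (K : Matrix κ κ ℂ) :
    (Matrix.diagonal δ * K * Matrix.diagonal ε).permanent =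
      (∏ i, δ i) * (∏ i, ε i) * K.permanent := by
  simp only [Matrix.permanent, Matrix.mul_diagonal, Matrix.diagonal_mul, Finset.prod_mul_distrib,
    Finset.mul_sum]
  refine Finset.sum_congr rfl fun σ _ => ?_
  rw [Equiv.prod_comp σ δ]
  ring

theorem condCov_mul_add (Λ Λ' : Matrix κ κ ℂ) (δ : κ → ℂ) (W Q : Matrix κ ι ℂ)
    (hΛ : Λ.det ≠ 0) (hW : (W * Wᴴ).det ≠ 0) :
    condCov (Λ * W * (Λ * W)ᴴ) ((Λ' * W + Matrix.diagonal δ * Q) * (Λ * W)ᴴ)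
        ((Λ' * W + Matrix.diagonal δ * Q) * (Λ' * W + Matrix.diagonal δ * Q)ᴴ) =
      Matrix.diagonal δ * condCov (W * Wᴴ) (Q * Wᴴ) (Q * Qᴴ) * (Matrix.diagonal δ)ᴴ := by
  set G := W * Wᴴ with hG
  have hGherm : Gᴴ = G := by simp [hG]
  have hcross : (Λ' * W + Matrix.diagonal δ * Q) * (Λ * W)ᴴ =
      (Λ' * G + Matrix.diagonal δ * (Q * Wᴴ)) * Λᴴ := by
    simp only [hG, Matrix.conjTranspose_mul, Matrix.add_mul, Matrix.mul_assoc]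
  have hinv : (Λ * W * (Λ * W)ᴴ)⁻¹ = Λᴴ⁻¹ * G⁻¹ * Λ⁻¹ := by
    rw [Matrix.conjTranspose_mul, Matrix.mul_assoc, ← Matrix.mul_assoc W, ← hG,
      Matrix.mul_inv_rev, Matrix.mul_inv_rev]
  have hΛstar : IsUnit Λᴴ.det := by simpa [Matrix.det_conjTranspose] using hΛ
  have hcancel (M : Matrix κ κ ℂ) : M * Λᴴ * (Λᴴ⁻¹ * G⁻¹ * Λ⁻¹) * (M * Λᴴ)ᴴ = M * G⁻¹ * Mᴴ := by
    rw [Matrix.conjTranspose_mul, Matrix.conjTranspose_conjTranspose]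
    simp only [Matrix.mul_assoc, Matrix.mul_nonsing_inv_cancel_left _ _ hΛstar,
      Matrix.nonsing_inv_mul_cancel_left _ _ hΛ.isUnit]
  rw [condCov, hcross, hinv, hcancel, condCov]
  simp only [Matrix.conjTranspose_add, Matrix.conjTranspose_mul, hGherm, Matrix.add_mul,
    Matrix.mul_add, Matrix.mul_sub, Matrix.sub_mul, Matrix.mul_assoc,
    Matrix.conjTranspose_conjTranspose]
  simp only [hG, Matrix.mul_assoc]
  simp only [← Matrix.mul_assoc W, ← hG, Matrix.nonsing_inv_mul_cancel_left _ _ hW.isUnit,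
    Matrix.mul_nonsing_inv_cancel_left _ _ hW.isUnit]
  abel

theorem gramZeroIntensity_mul_add (Λ Λ' : Matrix κ κ ℂ) (δ : κ → ℂ) (W Q : Matrix κ ι ℂ)
    (hΛ : Λ.det ≠ 0) (hW : (W * Wᴴ).det ≠ 0) :
    gramZeroIntensity (Λ * W) (Λ' * W + Matrix.diagonal δ * Q) =
      (((∏ i, ‖δ i‖ ^ 2) / ‖Λ.det‖ ^ 2 : ℝ) : ℂ) * gramZeroIntensity W Q := by
  have hdet : (Λ * W * (Λ * W)ᴴ).det = ((‖Λ.det‖ ^ 2 : ℝ) : ℂ) * (W * Wᴴ).det := by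
    rw [← det_mul_conjTranspose_self, Matrix.conjTranspose_mul, Matrix.mul_assoc,
      ← Matrix.mul_assoc W, Matrix.det_mul, Matrix.det_mul, Matrix.det_mul Λ]
    ring
  have hδ : (∏ i, δ i) * ∏ i, star δ i = ((∏ i, ‖δ i‖ ^ 2 : ℝ) : ℂ) := by
    simp [← Finset.prod_mul_distrib, Complex.mul_conj']
  rw [gramZeroIntensity, zeroIntensity, condCov_mul_add Λ Λ' δ W Q hΛ hW,
    Matrix.diagonal_conjTranspose, permanent_diagonal_mul_mul_diagonal, hδ, Matrix.det_smul, hdet,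
    gramZeroIntensity, zeroIntensity, Matrix.det_smul, Complex.ofReal_div]
  field_simp

theorem gramZeroIntensity_fromCols (R L : Matrix κ ν ℂ) (hR : (1 + Rᴴ * R).det ≠ 0) :
    gramZeroIntensity (Matrix.fromCols (1 : Matrix κ κ ℂ) R) (Matrix.fromCols 0 L) =
      (L * (1 + Rᴴ * R)⁻¹ * Lᴴ).permanent /
        ((Real.pi : ℂ) ^ Fintype.card κ * (1 + Rᴴ * R).det) := by
  have hdet : (1 + R * Rᴴ).det = (1 + Rᴴ * R).det := Matrix.det_one_add_mul_comm R Rᴴ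
  have hwoodbury : (1 + Rᴴ * R)⁻¹ = 1 - Rᴴ * (1 + R * Rᴴ)⁻¹ * R := by
    have h := Matrix.add_mul_mul_inv_eq_sub (1 : Matrix ν ν ℂ) Rᴴ (1 : Matrix κ κ ℂ) R isUnit_one
      isUnit_one (by simpa [Matrix.isUnit_iff_isUnit_det, hdet] using hR)
    simpa using h
  have hcond : condCov (1 + R * Rᴴ) (L * Rᴴ) (L * Lᴴ) = L * (1 + Rᴴ * R)⁻¹ * Lᴴ := by
    rw [condCov, hwoodbury]
    simp only [Matrix.conjTranspose_mul, Matrix.conjTranspose_conjTranspose, Matrix.mul_sub,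
      Matrix.sub_mul, Matrix.mul_one, Matrix.mul_assoc]
  rw [gramZeroIntensity, zeroIntensity]
  simp only [Matrix.conjTranspose_fromCols_eq_fromRows_conjTranspose,
    Matrix.fromCols_mul_fromRows, Matrix.conjTranspose_one, Matrix.conjTranspose_zero,
    Matrix.mul_one, Matrix.mul_zero, zero_add, hcond, Matrix.det_smul, hdet]

end ZeroIntensity

section KernelMatrix

open scoped Matrix ComplexOrder MatrixOrder

variable {κ ν : Type*} [Fintype κ] [DecidableEq κ] [Fintype ν] [DecidableEq ν]

/-- A matrix whose columns form a basis of the kernel of `E = [V | V₂]`, for invertible `V`. -/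
noncomputable def kernelMatrix (E : Matrix κ (κ ⊕ ν) ℂ) : Matrix (κ ⊕ ν) ν ℂ :=
  Matrix.fromRows (-(E.toCols₁⁻¹ * E.toCols₂)) 1

theorem kernelMatrix_mulVec_eq_iff {E : Matrix κ (κ ⊕ ν) ℂ} (hE : E.toCols₁.det ≠ 0) (t : ν → ℂ)
    (a : κ ⊕ ν → ℂ) : kernelMatrix E *ᵥ t = a ↔ t = a ∘ Sum.inr ∧ E *ᵥ a = 0 := by
  have hsplit (b : κ ⊕ ν → ℂ) :
      E *ᵥ b = E.toCols₁ *ᵥ (b ∘ Sum.inl) + E.toCols₂ *ᵥ (b ∘ Sum.inr) := by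
    conv_lhs => rw [← Matrix.fromCols_toCols E, Matrix.fromCols_mulVec]
  rw [kernelMatrix, Matrix.fromRows_mulVec, Matrix.one_mulVec, Matrix.neg_mulVec,
    ← Matrix.mulVec_mulVec]
  constructor
  · rintro rfl
    simp [hsplit, hE, Sum.elim_comp_inl, Sum.elim_comp_inr, Matrix.mulVec_neg]
  · rintro ⟨rfl, ha⟩
    rw [hsplit, add_eq_zero_iff_neg_eq'] at ha
    rw [← Matrix.mulVec_neg, ha, Matrix.mulVec_mulVec, Matrix.nonsing_inv_mul _ hE.isUnit,
      Matrix.one_mulVec, Sum.elim_comp_inl_inr]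

theorem kernelMatrix_mulVec_eq_sumElim {E : Matrix κ (κ ⊕ ν) ℂ} (hE : E.toCols₁.det ≠ 0)
    (a : κ → ℂ) (t : ν → ℂ) :
    kernelMatrix E *ᵥ t = Sum.elim (a - E.toCols₁⁻¹ *ᵥ (E *ᵥ Sum.elim a t)) t := by
  have hsplit : E *ᵥ Sum.elim a t = E.toCols₁ *ᵥ a + E.toCols₂ *ᵥ t := by
    conv_lhs => rw [← Matrix.fromCols_toCols E, Matrix.fromCols_mulVec_sumElim]
  rw [kernelMatrix, Matrix.fromRows_mulVec, Matrix.one_mulVec, hsplit, Matrix.mulVec_add,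
    Matrix.mulVec_mulVec, Matrix.nonsing_inv_mul _ hE.isUnit, Matrix.one_mulVec,
    Matrix.mulVec_mulVec, Matrix.neg_mulVec, sub_add_cancel_left]

theorem det_one_add_conjTranspose_mul_self_ne_zero {κ ν : Type*} [Fintype κ] [Fintype ν]
    [DecidableEq ν] (R : Matrix κ ν ℂ) : (1 + Rᴴ * R).det ≠ 0 :=
  (Matrix.PosDef.one.add_posSemidef (Matrix.posSemidef_conjTranspose_mul_self R)).det_pos.ne'

theorem conjTranspose_kernelMatrix_mul_self (E : Matrix κ (κ ⊕ ν) ℂ) :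
    (kernelMatrix E)ᴴ * kernelMatrix E =
      1 + (E.toCols₁⁻¹ * E.toCols₂)ᴴ * (E.toCols₁⁻¹ * E.toCols₂) := by
  rw [kernelMatrix, Matrix.conjTranspose_fromRows_eq_fromCols_conjTranspose,
    Matrix.fromCols_mul_fromRows, Matrix.conjTranspose_neg, Matrix.neg_mul, Matrix.mul_neg, neg_neg,
    Matrix.conjTranspose_one, Matrix.mul_one, add_comm]

theorem gramZeroIntensity_eq_kernelMatrix {E : Matrix κ (κ ⊕ ν) ℂ} (hE : E.toCols₁.det ≠ 0)
    (D : Matrix κ (κ ⊕ ν) ℂ) :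
    gramZeroIntensity E D =
      ((Real.pi ^ Fintype.card κ * ‖E.toCols₁.det‖ ^ 2 : ℝ) : ℂ)⁻¹ *
      ((D * kernelMatrix E * ((kernelMatrix E)ᴴ * kernelMatrix E)⁻¹ *
        (D * kernelMatrix E)ᴴ).permanent / ((kernelMatrix E)ᴴ * kernelMatrix E).det) := by
  set R := E.toCols₁⁻¹ * E.toCols₂ with hR
  set L := D * kernelMatrix E with hL
  have hLeq : L = D.toCols₂ - D.toCols₁ * R := by
    rw [hL, kernelMatrix, ← hR]
    conv_lhs => rw [← Matrix.fromCols_toCols D, Matrix.fromCols_mul_fromRows]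
    simp [sub_eq_neg_add]
  have hEeq : E = E.toCols₁ * Matrix.fromCols (1 : Matrix κ κ ℂ) R := by
    rw [Matrix.mul_fromCols, hR, Matrix.mul_nonsing_inv_cancel_left _ _ hE.isUnit, Matrix.mul_one,
      Matrix.fromCols_toCols]
  have hDeq : D = D.toCols₁ * Matrix.fromCols (1 : Matrix κ κ ℂ) R +
      Matrix.diagonal (1 : κ → ℂ) * Matrix.fromCols (0 : Matrix κ κ ℂ) L := by
    rw [Matrix.diagonal_one', Matrix.one_mul, Matrix.mul_fromCols, Matrix.mul_one, hLeq]
    ext i (j | j) <;> simp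
  have hdet : (Matrix.fromCols (1 : Matrix κ κ ℂ) R * (Matrix.fromCols (1 : Matrix κ κ ℂ) R)ᴴ).det
      ≠ 0 := by
    rw [Matrix.conjTranspose_fromCols_eq_fromRows_conjTranspose, Matrix.fromCols_mul_fromRows]
    simpa using det_one_add_conjTranspose_mul_self_ne_zero Rᴴ
  conv_lhs => rw [hEeq, hDeq]
  rw [gramZeroIntensity_mul_add _ _ _ _ _ hE hdet,
    gramZeroIntensity_fromCols _ _ (det_one_add_conjTranspose_mul_self_ne_zero R),
    conjTranspose_kernelMatrix_mul_self, ← hR]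
  simp only [Pi.one_apply, norm_one, one_pow, Finset.prod_const_one]
  push_cast
  field_simp

theorem lintegral_prod_norm_sq_kernelMatrix_mul_stdGaussianPDF {E : Matrix κ (κ ⊕ ν) ℂ}
    (hE : E.toCols₁.det ≠ 0) (D : Matrix κ (κ ⊕ ν) ℂ) :
    ∫⁻ t, ENNReal.ofReal ((∏ i, ‖(D *ᵥ (kernelMatrix E *ᵥ t)) i‖ ^ 2) / ‖E.toCols₁.det‖ ^ 2) *
        stdGaussianPDF (kernelMatrix E *ᵥ t) =
      ENNReal.ofReal (gramZeroIntensity E D).re := by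
  have hgram : ((kernelMatrix E)ᴴ * kernelMatrix E).det ≠ 0 := by
    rw [conjTranspose_kernelMatrix_mul_self]
    exact det_one_add_conjTranspose_mul_self_ne_zero _
  rw [gramZeroIntensity_eq_kernelMatrix hE, ← Complex.ofReal_inv, Complex.re_ofReal_mul,
    ENNReal.ofReal_mul (by positivity),
    ← lintegral_prod_norm_sq_mulVec_mul_exp _ _ hgram,
    ← lintegral_const_mul' _ _ ENNReal.ofReal_ne_top]
  refine lintegral_congr fun t => ?_
  rw [stdGaussianPDF, ← ENNReal.ofReal_mul (by positivity), ← ENNReal.ofReal_mul (by positivity),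
    ← ENNReal.ofReal_mul (by positivity), Matrix.mulVec_mulVec, Fintype.card_sum, pow_add]
  congr 1
  field_simp

end KernelMatrix

section KacRice

open scoped Matrix

variable {κ ν : Type*} [Fintype κ] [DecidableEq κ] [Fintype ν] [DecidableEq ν]

theorem hasFDerivAt_mul_of_eq_zero {E : Type*} [NormedAddCommGroup E] [NormedSpace ℂ E]
    {u v : E → ℂ} {v' : E →L[ℂ] ℂ} {x : E} (hu : ContinuousAt u x) (hv : HasFDerivAt v v' x)
    (hx : v x = 0) : HasFDerivAt (fun y => u y * v y) (u x • v') x := by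
  have hremainder : (fun y => (u y - u x) * v y) =o[𝓝 x] fun y => y - x := by
    have hsmall : (fun y => u y - u x) =o[𝓝 x] fun _ => (1 : ℝ) :=
      (Asymptotics.isLittleO_one_iff ℝ).2 (by simpa using hu.sub_const (u x))
    have hbig : v =O[𝓝 x] fun y => ‖y - x‖ := by simpa [hx] using hv.isBigO_sub.norm_right
    simpa using hsmall.mul_isBigO hbig
  refine .of_isLittleO ((hremainder.add ((hv.isLittleO).const_mul_left (u x))).congr_left
    fun y => ?_)
  simp only [hx, smul_apply, smul_eq_mul]
  ring

theorem hasFDerivAt_mulVec_of_eq_zero {κ ι E : Type*} [Fintype κ] [DecidableEq κ] [Finite ι]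
    [NormedAddCommGroup E] [NormedSpace ℂ E] {u : E → Matrix ι κ ℂ} {v : E → κ → ℂ}
    {v' : E →L[ℂ] κ → ℂ} {x : E} (hu : ∀ i j, ContinuousAt (fun y => u y i j) x)
    (hv : HasFDerivAt v v' x) (hx : v x = 0) :
    HasFDerivAt (fun y => u y *ᵥ v y) ((u x).toLin'.toContinuousLinearMap ∘L v') x := by
  cases nonempty_fintype ι
  refine hasFDerivAt_pi'.2 fun i => (HasFDerivAt.fun_sum (u := Finset.univ) fun j _ =>
    hasFDerivAt_mul_of_eq_zero (hu i j) (hasFDerivAt_pi'.1 hv j) (congrFun hx j)).congr_fderiv ?_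
  ext w
  simp [Matrix.mulVec, dotProduct]

theorem measurable_matrix_inv_apply {X : Type*} [MeasurableSpace X] [TopologicalSpace X]
    [BorelSpace X] {A : X → Matrix κ κ ℂ} (hA : Continuous A) (i j : κ) :
    Measurable fun x => (A x)⁻¹ i j := by
  simp only [Matrix.inv_def, Ring.inverse_eq_inv, Matrix.smul_apply, smul_eq_mul]
  exact hA.matrix_det.measurable.inv.mul (hA.matrix_adjugate.matrix_elem i j).measurable

/-- The matrix of the evaluations at `z` of the combinations `∑ a_l φ_l`, as functions of `a`. -/
def evalMatrix {κ ι : Type*} (φ : ι → ℂ → ℂ) (z : κ → ℂ) : Matrix κ ι ℂ :=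
  Matrix.of fun i l => φ l (z i)

/-- For `c = (z, t)`, the coefficients `a` with `a ∘ inr = t` for which `∑ a_l φ_l` vanishes at
the points `z_i`. -/
noncomputable def zeroCoeffs (φ : κ ⊕ ν → ℂ → ℂ) (c : κ ⊕ ν → ℂ) : κ ⊕ ν → ℂ :=
  kernelMatrix (evalMatrix φ (c ∘ Sum.inl)) *ᵥ (c ∘ Sum.inr)

/-- The Jacobian matrix of `zeroCoeffs`. -/
noncomputable def zeroCoeffsJacobian (φ : κ ⊕ ν → ℂ → ℂ) (c : κ ⊕ ν → ℂ) :
    Matrix (κ ⊕ ν) (κ ⊕ ν) ℂ :=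
  Matrix.fromBlocks
    (-(evalMatrix φ (c ∘ Sum.inl)).toCols₁⁻¹ *
      Matrix.diagonal (evalMatrix (fun l => deriv (φ l)) (c ∘ Sum.inl) *ᵥ zeroCoeffs φ c))
    (-((evalMatrix φ (c ∘ Sum.inl)).toCols₁⁻¹ * (evalMatrix φ (c ∘ Sum.inl)).toCols₂)) 0 1

theorem continuous_evalMatrix {κ ι : Type*} {φ : ι → ℂ → ℂ} (hφ : ∀ l, Continuous (φ l)) :
    Continuous (evalMatrix φ : (κ → ℂ) → Matrix κ ι ℂ) :=
  continuous_matrix fun i l => (hφ l).comp (continuous_apply i)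

variable {φ : κ ⊕ ν → ℂ → ℂ}

theorem continuous_evalMatrix_comp_inl {κ ν : Type*} {φ : κ ⊕ ν → ℂ → ℂ}
    (hφ : ∀ l, Continuous (φ l)) :
    Continuous fun c : κ ⊕ ν → ℂ => evalMatrix φ (c ∘ (Sum.inl : κ → κ ⊕ ν)) :=
  (continuous_evalMatrix hφ).comp (continuous_pi fun i => continuous_apply (Sum.inl i))

theorem continuous_toCols₁_evalMatrix {κ ν : Type*} {φ : κ ⊕ ν → ℂ → ℂ}
    (hφ : ∀ l, Continuous (φ l)) :
    Continuous fun c : κ ⊕ ν → ℂ => (evalMatrix φ (c ∘ (Sum.inl : κ → κ ⊕ ν))).toCols₁ :=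
  continuous_matrix fun i l => (continuous_evalMatrix_comp_inl hφ).matrix_elem i (Sum.inl l)

theorem measurable_zeroCoeffs (hφ : ∀ l, Continuous (φ l)) : Measurable (zeroCoeffs φ) := by
  refine measurable_pi_iff.2 fun l => Finset.measurable_fun_sum _ fun j _ =>
    Measurable.mul ?_ (measurable_pi_apply (Sum.inr j))
  rcases l with i | j'
  · simp only [kernelMatrix, Matrix.fromRows_apply_inl, Matrix.neg_apply, Matrix.mul_apply]
    exact (Finset.measurable_fun_sum _ fun m _ =>
      (measurable_matrix_inv_apply (continuous_toCols₁_evalMatrix hφ) i m).mul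
        ((continuous_evalMatrix_comp_inl hφ).matrix_elem m (Sum.inr j)).measurable).neg
  · exact measurable_const

theorem norm_det_zeroCoeffsJacobian_sq (φ : κ ⊕ ν → ℂ → ℂ) (c : κ ⊕ ν → ℂ) :
    ‖(zeroCoeffsJacobian φ c).det‖ ^ 2 =
      (∏ i, ‖(evalMatrix (fun l => deriv (φ l)) (c ∘ Sum.inl) *ᵥ zeroCoeffs φ c) i‖ ^ 2) /
        ‖(evalMatrix φ (c ∘ Sum.inl)).toCols₁.det‖ ^ 2 := by
  rw [zeroCoeffsJacobian, Matrix.det_fromBlocks_zero₂₁, Matrix.det_one, mul_one, Matrix.neg_mul,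
    Matrix.det_neg, Matrix.det_mul, Matrix.det_diagonal, Matrix.det_nonsing_inv,
    Ring.inverse_eq_inv]
  simp only [norm_mul, norm_pow, norm_neg, norm_one, one_pow, one_mul, norm_inv, norm_prod,
    mul_pow, Finset.prod_pow, inv_pow]
  rw [mul_comm, div_eq_mul_inv]

theorem hasFDerivAt_evalMatrix_mulVec {κ ν : Type*} [Fintype κ] [DecidableEq κ] [Fintype ν]
    [DecidableEq ν] {φ : κ ⊕ ν → ℂ → ℂ} (hφ : ∀ l, Differentiable ℂ (φ l)) (a : κ → ℂ)
    (c : κ ⊕ ν → ℂ) :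
    HasFDerivAt (fun c' : κ ⊕ ν → ℂ =>
        evalMatrix φ (c' ∘ (Sum.inl : κ → κ ⊕ ν)) *ᵥ Sum.elim a (c' ∘ Sum.inr))
      (Matrix.fromCols
        (Matrix.diagonal
          (evalMatrix (fun l => deriv (φ l)) (c ∘ Sum.inl) *ᵥ Sum.elim a (c ∘ Sum.inr)))
        (evalMatrix φ (c ∘ Sum.inl)).toCols₂).toLin'.toContinuousLinearMap c := by
  refine hasFDerivAt_pi'.2 fun i => ?_
  have hcoord (l : κ ⊕ ν) : HasFDerivAt (fun c' : κ ⊕ ν → ℂ => c' l)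
      (ContinuousLinearMap.proj (R := ℂ) (φ := fun _ : κ ⊕ ν => ℂ) l) c := hasFDerivAt_apply l c
  have hval (l : κ ⊕ ν) :=
    (hφ l (c (Sum.inl i))).hasDerivAt.comp_hasFDerivAt c (hcoord (Sum.inl i))
  have hinl := HasFDerivAt.fun_sum (u := Finset.univ) fun l _ => (hval (Sum.inl l)).mul_const (a l)
  have hinr := HasFDerivAt.fun_sum (u := Finset.univ) fun j _ =>
    (hval (Sum.inr j)).mul (hcoord (Sum.inr j))
  refine ((hinl.add hinr).congr_fderiv ?_).congr_of_eventuallyEq (.of_forall fun c' => ?_)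
  · ext v
    simp only [ContinuousLinearMap.comp_apply, ContinuousLinearMap.proj_apply,
      LinearMap.coe_toContinuousLinearMap', Matrix.toLin'_apply, Matrix.fromCols_mulVec,
      Pi.add_apply, Matrix.mulVec_diagonal, add_apply, sum_apply, smul_apply, smul_eq_mul]
    simp only [evalMatrix, Matrix.mulVec, dotProduct, Fintype.sum_sum_type, Matrix.of_apply,
      Matrix.toCols₂_apply, Sum.elim_inl, Sum.elim_inr, Function.comp_apply, add_mul,
      Finset.sum_mul, Finset.sum_add_distrib]
    rw [add_assoc, add_comm (∑ j, φ (Sum.inr j) (c (Sum.inl i)) * v (Sum.inr j))]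
    congr 1
    · exact Finset.sum_congr rfl fun l _ => by ring
    · congr 1
      exact Finset.sum_congr rfl fun l _ => by ring
  · simp [evalMatrix, Matrix.mulVec, dotProduct, Fintype.sum_sum_type]

theorem continuousAt_inv_toCols₁_evalMatrix {κ ν : Type*} [Fintype κ] [DecidableEq κ]
    {φ : κ ⊕ ν → ℂ → ℂ} (hφ : ∀ l, Continuous (φ l)) {c : κ ⊕ ν → ℂ}
    (hc : (evalMatrix φ (c ∘ Sum.inl)).toCols₁.det ≠ 0) (i j : κ) :
    ContinuousAt (fun c' : κ ⊕ ν → ℂ => (evalMatrix φ (c' ∘ Sum.inl)).toCols₁⁻¹ i j) c := by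
  have hdet : ContinuousAt Ring.inverse (evalMatrix φ (c ∘ Sum.inl)).toCols₁.det := by
    simpa only [Ring.inverse_eq_inv'] using continuousAt_inv₀ hc
  have hinv := (continuousAt_matrix_inv _ hdet).comp
    (f := fun c' : κ ⊕ ν → ℂ => (evalMatrix φ (c' ∘ Sum.inl)).toCols₁)
    (continuous_toCols₁_evalMatrix hφ).continuousAt
  exact (continuous_id.matrix_elem i j).continuousAt.comp hinv

theorem zeroCoeffs_eq_iff {c : κ ⊕ ν → ℂ} (hc : (evalMatrix φ (c ∘ Sum.inl)).toCols₁.det ≠ 0)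
    (a : κ ⊕ ν → ℂ) :
    zeroCoeffs φ c = a ↔ c ∘ Sum.inr = a ∘ Sum.inr ∧ evalMatrix φ (c ∘ Sum.inl) *ᵥ a = 0 :=
  kernelMatrix_mulVec_eq_iff hc _ a

theorem hasFDerivAt_zeroCoeffs (hφ : ∀ l, Differentiable ℂ (φ l)) {c : κ ⊕ ν → ℂ}
    (hc : (evalMatrix φ (c ∘ Sum.inl)).toCols₁.det ≠ 0) :
    HasFDerivAt (zeroCoeffs φ) (realMulVecCLM (zeroCoeffsJacobian φ c)) c := by
  obtain ⟨hinr, hzero⟩ := (zeroCoeffs_eq_iff hc _).1 rfl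
  set a : κ → ℂ := zeroCoeffs φ c ∘ Sum.inl with ha
  have hcont : ∀ l, Continuous (φ l) := fun l => (hφ l).continuous
  have helim : Sum.elim a (c ∘ Sum.inr) = zeroCoeffs φ c := by
    rw [hinr, ha, Sum.elim_comp_inl_inr]
  have hnear : zeroCoeffs φ =ᶠ[𝓝 c] fun c' => Sum.elim
      (a - (evalMatrix φ (c' ∘ Sum.inl)).toCols₁⁻¹ *ᵥ
        (evalMatrix φ (c' ∘ Sum.inl) *ᵥ Sum.elim a (c' ∘ Sum.inr))) (c' ∘ Sum.inr) := by
    filter_upwards [(continuous_toCols₁_evalMatrix hcont).matrix_det.continuousAt.eventually_ne hc]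
      with c' hc' using kernelMatrix_mulVec_eq_sumElim hc' a _
  have hres := (hasFDerivAt_mulVec_of_eq_zero (continuousAt_inv_toCols₁_evalMatrix hcont hc)
    (hasFDerivAt_evalMatrix_mulVec hφ a c) (by rw [helim, hzero])).const_sub a
  suffices HasFDerivAt (zeroCoeffs φ) (zeroCoeffsJacobian φ c).toLin'.toContinuousLinearMap c from
    this.restrictScalars ℝ
  refine HasFDerivAt.congr_of_eventuallyEq (hasFDerivAt_pi'.2 fun l => ?_) hnear
  rcases l with i | j
  · refine (hasFDerivAt_pi'.1 hres i).congr_fderiv (ContinuousLinearMap.ext fun v => ?_)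
    simp [helim, zeroCoeffsJacobian, Matrix.fromBlocks_mulVec, Matrix.fromCols_mulVec,
      Matrix.mulVec_add, Matrix.mulVec_mulVec, Matrix.neg_mulVec, add_comm]
  · refine (hasFDerivAt_apply (Sum.inr j) c).congr_fderiv (ContinuousLinearMap.ext fun v => ?_)
    simp [zeroCoeffsJacobian, Matrix.fromBlocks_mulVec]

end KacRice

section KacRiceFormula

open scoped Matrix

variable {κ ν : Type*} [Fintype κ] [DecidableEq κ] [Fintype ν] [DecidableEq ν]
  {φ : κ ⊕ ν → ℂ → ℂ} {ψ : (κ → ℂ) → ℝ≥0∞}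

theorem lintegral_sumElim {ι κ : Type*} [Fintype ι] [Fintype κ] {f : (ι ⊕ κ → ℂ) → ℝ≥0∞}
    (hf : Measurable f) : ∫⁻ c, f c = ∫⁻ z : ι → ℂ, ∫⁻ t : κ → ℂ, f (Sum.elim z t) := by
  rw [← (volume_measurePreserving_sumPiEquivProdPi_symm fun _ : ι ⊕ κ => ℂ).lintegral_comp hf,
    Measure.volume_eq_prod]
  refine (lintegral_prod _ (hf.comp (MeasurableEquiv.measurable _)).aemeasurable).trans ?_
  refine lintegral_congr fun z => lintegral_congr fun t => congrArg f ?_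
  ext (i | i) <;> rfl

theorem measurable_comp_inl {κ ν : Type*} :
    Measurable fun c : κ ⊕ ν → ℂ => c ∘ (Sum.inl : κ → κ ⊕ ν) :=
  measurable_pi_lambda _ fun i => measurable_pi_apply (Sum.inl i)

theorem setLIntegral_preimage_comp_inl {ι κ : Type*} [Fintype ι] [Fintype κ] {s : Set (ι → ℂ)}
    (hs : MeasurableSet s) {f : (ι ⊕ κ → ℂ) → ℝ≥0∞} (hf : Measurable f) :
    ∫⁻ c in (fun c => c ∘ Sum.inl) ⁻¹' s, f c = ∫⁻ z in s, ∫⁻ t : κ → ℂ, f (Sum.elim z t) := by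
  rw [← lintegral_indicator (measurable_comp_inl hs),
    lintegral_sumElim (hf.indicator (measurable_comp_inl hs)), ← lintegral_indicator hs]
  refine lintegral_congr fun z => ?_
  by_cases hz : z ∈ s <;> simp [Set.indicator, hz]

theorem measurableSet_det_toCols₁_evalMatrix_ne_zero {κ ν : Type*} [Fintype κ] [DecidableEq κ]
    {φ : κ ⊕ ν → ℂ → ℂ} (hφ : ∀ l, Continuous (φ l)) :
    MeasurableSet {z : κ → ℂ | (evalMatrix φ z).toCols₁.det ≠ 0} :=
  (isOpen_ne_fun (continuous_matrix fun i j => (continuous_evalMatrix hφ).matrix_elem i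
    (Sum.inl j)).matrix_det continuous_const).measurableSet

theorem tsum_zeros_eq_tsum_preimage (φ : κ ⊕ ν → ℂ → ℂ) (ψ : (κ → ℂ) → ℝ≥0∞) (a : κ ⊕ ν → ℂ) :
    ∑' z : {z : κ → ℂ | (evalMatrix φ z).toCols₁.det ≠ 0 ∧ evalMatrix φ z *ᵥ a = 0}, ψ z =
      ∑' c : ↥((fun c => c ∘ Sum.inl) ⁻¹' {z : κ → ℂ | (evalMatrix φ z).toCols₁.det ≠ 0} ∩
        zeroCoeffs φ ⁻¹' {a}), ψ (c.1 ∘ Sum.inl) := by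
  refine (Equiv.tsum_eq (Equiv.ofBijective
    (fun c : ↥((fun c => c ∘ Sum.inl) ⁻¹' {z : κ → ℂ | (evalMatrix φ z).toCols₁.det ≠ 0} ∩
      zeroCoeffs φ ⁻¹' {a}) => ⟨c.1 ∘ Sum.inl, c.2.1, ((zeroCoeffs_eq_iff c.2.1 a).1 c.2.2).2⟩)
    ⟨fun c c' h => ?_, fun z => ?_⟩) fun z :
      {z : κ → ℂ | (evalMatrix φ z).toCols₁.det ≠ 0 ∧ evalMatrix φ z *ᵥ a = 0} => ψ z).symm
  · have hinl : c.1 ∘ Sum.inl = c'.1 ∘ Sum.inl := congrArg Subtype.val h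
    have hinr : c.1 ∘ Sum.inr = c'.1 ∘ Sum.inr :=
      ((zeroCoeffs_eq_iff c.2.1 a).1 c.2.2).1.trans ((zeroCoeffs_eq_iff c'.2.1 a).1 c'.2.2).1.symm
    rw [Subtype.ext_iff, ← Sum.elim_comp_inl_inr c.1, hinl, hinr, Sum.elim_comp_inl_inr]
  · exact ⟨⟨Sum.elim z.1 (a ∘ Sum.inr), z.2.1, (zeroCoeffs_eq_iff z.2.1 a).2 ⟨rfl, z.2.2⟩⟩, rfl⟩

theorem measurable_det_zeroCoeffsJacobian (hφ : ∀ l, Differentiable ℂ (φ l)) :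
    Measurable fun c => (realMulVecCLM (zeroCoeffsJacobian φ c)).det := by
  simp only [det_realMulVecCLM, norm_det_zeroCoeffsJacobian_sq]
  refine Measurable.div (Finset.measurable_fun_prod _ fun i _ => Measurable.pow_const
    (Measurable.norm (Finset.measurable_fun_sum _ fun l _ => Measurable.mul
      ((measurable_deriv (φ l)).comp (measurable_pi_apply (Sum.inl i)))
      (measurable_pi_iff.1 (measurable_zeroCoeffs fun l => (hφ l).continuous) l))) 2) ?_
  exact ((continuous_toCols₁_evalMatrix fun l =>
    (hφ l).continuous).matrix_det.norm.pow 2).measurable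

theorem lintegral_det_zeroCoeffsJacobian_mul_stdGaussianPDF {z : κ → ℂ}
    (hz : (evalMatrix φ z).toCols₁.det ≠ 0) :
    ∫⁻ t, ENNReal.ofReal |(realMulVecCLM (zeroCoeffsJacobian φ (Sum.elim z t))).det| *
        stdGaussianPDF (zeroCoeffs φ (Sum.elim z t)) =
      ENNReal.ofReal
        (gramZeroIntensity (evalMatrix φ z) (evalMatrix (fun l => deriv (φ l)) z)).re := by
  rw [← lintegral_prod_norm_sq_kernelMatrix_mul_stdGaussianPDF hz]
  refine lintegral_congr fun t => ?_
  rw [det_realMulVecCLM, norm_det_zeroCoeffsJacobian_sq, abs_of_nonneg (by positivity), zeroCoeffs,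
    Sum.elim_comp_inl, Sum.elim_comp_inr]

theorem aemeasurable_tsum_zeros {ν : Type*} [Fintype ν] {φ : κ ⊕ ν → ℂ → ℂ}
    (hφ : ∀ l, Differentiable ℂ (φ l)) (hψ : Measurable ψ) :
    AEMeasurable (fun a => ∑' z : {z : κ → ℂ | (evalMatrix φ z).toCols₁.det ≠ 0 ∧
      evalMatrix φ z *ᵥ a = 0}, ψ z) (Measure.pi fun _ : κ ⊕ ν => stdComplexGaussian) := by
  classical
  rw [pi_stdComplexGaussian]
  simp only [tsum_zeros_eq_tsum_preimage]
  exact (aemeasurable_tsum_preimage volume (measurable_comp_inl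
      (measurableSet_det_toCols₁_evalMatrix_ne_zero fun l => (hφ l).continuous))
    (fun c hc => (hasFDerivAt_zeroCoeffs hφ hc).hasFDerivWithinAt)
    (measurable_det_zeroCoeffsJacobian hφ) (hψ.comp measurable_comp_inl)).mono_ac
    (withDensity_absolutelyContinuous _ _)

/-- This is the area formula for `zeroCoeffs φ`, whose fibre over `a` consists of the tuples of
zeros of `∑ a_l φ_l`. -/
theorem lintegral_tsum_zeros {ν : Type*} [Fintype ν] {φ : κ ⊕ ν → ℂ → ℂ}
    (hφ : ∀ l, Differentiable ℂ (φ l)) (hψ : Measurable ψ) :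
    ∫⁻ a, ∑' z : {z : κ → ℂ | (evalMatrix φ z).toCols₁.det ≠ 0 ∧ evalMatrix φ z *ᵥ a = 0}, ψ z
        ∂Measure.pi (fun _ : κ ⊕ ν => stdComplexGaussian) =
      ∫⁻ z in {z | (evalMatrix φ z).toCols₁.det ≠ 0},
        ψ z * ENNReal.ofReal
          (gramZeroIntensity (evalMatrix φ z) (evalMatrix (fun l => deriv (φ l)) z)).re := by
  classical
  set s := {z : κ → ℂ | (evalMatrix φ z).toCols₁.det ≠ 0}
  have hs : MeasurableSet s :=
    measurableSet_det_toCols₁_evalMatrix_ne_zero fun l => (hφ l).continuous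
  have hdet := measurable_det_zeroCoeffsJacobian hφ
  have hpdf : Measurable fun c => stdGaussianPDF (zeroCoeffs φ c) :=
    measurable_stdGaussianPDF.comp (measurable_zeroCoeffs fun l => (hφ l).continuous)
  have hψ' : Measurable fun c : κ ⊕ ν → ℂ => ψ (c ∘ Sum.inl) := hψ.comp measurable_comp_inl
  calc _ = ∫⁻ a, ∑' c : ↥((fun c => c ∘ Sum.inl) ⁻¹' s ∩ zeroCoeffs φ ⁻¹' {a}),
          ψ (c.1 ∘ Sum.inl) * stdGaussianPDF (zeroCoeffs φ c.1) := by
        rw [pi_stdComplexGaussian, lintegral_withDensity_eq_lintegral_mul_non_measurable _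
          measurable_stdGaussianPDF (.of_forall fun a => (stdGaussianPDF_ne_top a).lt_top)]
        refine lintegral_congr fun a => ?_
        rw [Pi.mul_apply, tsum_zeros_eq_tsum_preimage, mul_comm, ← ENNReal.tsum_mul_right]
        exact tsum_congr fun c => by rw [show zeroCoeffs φ c.1 = a from c.2.2]
    _ = ∫⁻ c in (fun c => c ∘ Sum.inl) ⁻¹' s,
          ENNReal.ofReal |(realMulVecCLM (zeroCoeffsJacobian φ c)).det| *
            (ψ (c ∘ Sum.inl) * stdGaussianPDF (zeroCoeffs φ c)) :=
        lintegral_tsum_preimage volume (measurable_comp_inl hs)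
          (fun c hc => (hasFDerivAt_zeroCoeffs hφ hc).hasFDerivWithinAt) hdet (hψ'.mul hpdf)
    _ = ∫⁻ z in s, ∫⁻ t,
          ENNReal.ofReal |(realMulVecCLM (zeroCoeffsJacobian φ (Sum.elim z t))).det| *
            (ψ z * stdGaussianPDF (zeroCoeffs φ (Sum.elim z t))) := by
        exact setLIntegral_preimage_comp_inl hs (hdet.abs.ennreal_ofReal.mul (hψ'.mul hpdf))
    _ = _ := setLIntegral_congr_fun hs fun z hz => by
        simp only [mul_left_comm _ (ψ z)]
        rw [← lintegral_det_zeroCoeffsJacobian_mul_stdGaussianPDF hz, lintegral_const_mul]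
        exact (hdet.abs.ennreal_ofReal.mul hpdf).comp (measurable_pi_iff.2 fun l => by
          rcases l with i | j <;> simp only [Sum.elim_inl, Sum.elim_inr] <;> fun_prop)

end KacRiceFormula

section NewtonInterpolation

variable {R : Type*} [CommRing R]

/-- The divided difference of `X ^ m` at the nodes `x 0, …, x j`. -/
def newtonCoeff (x : ℕ → R) : ℕ → ℕ → R
  | 0, 0 => 1
  | 0, _ + 1 => 0
  | m + 1, 0 => x 0 * newtonCoeff x m 0
  | m + 1, j + 1 => x (j + 1) * newtonCoeff x m (j + 1) + newtonCoeff x m j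

theorem newtonCoeff_congr {x x' : ℕ → R} {j : ℕ} (h : ∀ i ≤ j, x i = x' i) (m : ℕ) :
    newtonCoeff x m j = newtonCoeff x' m j := by
  induction m generalizing j with
  | zero => cases j <;> rfl
  | succ m ih =>
    cases j with
    | zero => simp only [newtonCoeff, ih h, h 0 le_rfl]
    | succ j =>
      simp only [newtonCoeff, ih h, ih fun i hi => h i (hi.trans j.le_succ), h (j + 1) le_rfl]

theorem newtonCoeff_eq_zero_of_lt (x : ℕ → R) {m j : ℕ} (h : m < j) : newtonCoeff x m j = 0 := by
  induction m generalizing j with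
  | zero => cases j with
    | zero => exact absurd h (lt_irrefl 0)
    | succ j => rfl
  | succ m ih => cases j with
    | zero => exact absurd h (Nat.not_lt_zero _)
    | succ j =>
      rw [newtonCoeff, ih (Nat.lt_of_succ_lt h), ih (Nat.lt_of_succ_lt_succ h), mul_zero, add_zero]

theorem newtonCoeff_self (x : ℕ → R) (j : ℕ) : newtonCoeff x j j = 1 := by
  induction j with
  | zero => rfl
  | succ j ih =>
    rw [newtonCoeff, newtonCoeff_eq_zero_of_lt x j.lt_succ_self, ih, mul_zero, zero_add]

theorem sum_newtonCoeff_succ_mul_prod (x : ℕ → R) (X : R) (m k : ℕ) :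
    ∑ j ∈ Finset.range (k + 1), newtonCoeff x (m + 1) j * ∏ i ∈ Finset.range j, (X - x i) =
      X * ∑ j ∈ Finset.range (k + 1), newtonCoeff x m j * ∏ i ∈ Finset.range j, (X - x i) -
        newtonCoeff x m k * ∏ i ∈ Finset.range (k + 1), (X - x i) := by
  induction k with
  | zero => simp [newtonCoeff]; ring
  | succ k ih =>
    rw [Finset.sum_range_succ, ih, Finset.sum_range_succ _ (k + 1), newtonCoeff,
      Finset.prod_range_succ _ (k + 1)]
    ring

theorem pow_eq_sum_newtonCoeff_mul_prod (x : ℕ → R) (m k : ℕ) :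
    x k ^ m =
      ∑ j ∈ Finset.range (k + 1), newtonCoeff x m j * ∏ i ∈ Finset.range j, (x k - x i) := by
  induction m with
  | zero => simp [Finset.sum_range_succ', newtonCoeff]
  | succ m ih =>
    rw [sum_newtonCoeff_succ_mul_prod, ← ih, Finset.prod_range_succ, sub_self, mul_zero, mul_zero,
      sub_zero, pow_succ']

theorem continuous_newtonCoeff [TopologicalSpace R] [IsTopologicalRing R] (m j : ℕ) :
    Continuous fun x : ℕ → R => newtonCoeff x m j := by
  induction m generalizing j with
  | zero => cases j <;> exact continuous_const
  | succ m ih =>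
    cases j with
    | zero => exact (continuous_apply 0).mul (ih 0)
    | succ j => exact ((continuous_apply (j + 1)).mul (ih (j + 1))).add (ih j)

theorem norm_newtonCoeff_le {R : Type*} [NormedCommRing R] [NormOneClass R] {x : ℕ → R} {r ε : ℝ}
    (hε : 0 < ε) (hx : ∀ i, ‖x i‖ ≤ r) (m j : ℕ) :
    ‖newtonCoeff x m j‖ ≤ (r + ε) ^ m / ε ^ j := by
  have hr : 0 ≤ r := (norm_nonneg _).trans (hx 0)
  induction m generalizing j with
  | zero =>
    cases j with
    | zero => simp only [newtonCoeff, norm_one, pow_zero, div_one, le_refl]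
    | succ j =>
      rw [newtonCoeff, norm_zero]
      positivity
  | succ m ih =>
    cases j with
    | zero =>
      calc ‖x 0 * newtonCoeff x m 0‖ ≤ r * ((r + ε) ^ m / ε ^ 0) :=
            norm_mul_le_of_le (hx 0) (ih 0)
        _ ≤ (r + ε) ^ (m + 1) / ε ^ 0 := by
            rw [pow_succ', mul_div_assoc]
            gcongr
            exact le_add_of_nonneg_right hε.le
    | succ j =>
      calc ‖x (j + 1) * newtonCoeff x m (j + 1) + newtonCoeff x m j‖
          ≤ r * ((r + ε) ^ m / ε ^ (j + 1)) + (r + ε) ^ m / ε ^ j :=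
            norm_add_le_of_le (norm_mul_le_of_le (hx _) (ih _)) (ih j)
        _ = (r + ε) ^ (m + 1) / ε ^ (j + 1) := by field_simp; ring

end NewtonInterpolation

section NewtonMatrices

open scoped Matrix

variable {k : ℕ}

/-- The sequence `z 0, …, z (k - 1), w, w, …`. -/
def extendTuple (z : Fin k → ℂ) (w : ℂ) (i : ℕ) : ℂ :=
  if h : i < k then z ⟨i, h⟩ else w

/-- The coefficients of `1, X, X ^ 2, …` on the Newton basis `∏ l < j, (X - z l)`, `j < k`,
modulo `∏ l, (X - z l)`. -/
def newtonMatrix (z : Fin k → ℂ) : Matrix (Fin k) ℕ ℂ :=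
  Matrix.of fun j m => newtonCoeff (extendTuple z 0) m j

/-- The values at `z i` of the quotients of `1, X, X ^ 2, …` by `∏ l, (X - z l)`. -/
def newtonQuotient (z : Fin k → ℂ) : Matrix (Fin k) ℕ ℂ :=
  Matrix.of fun i m => newtonCoeff (extendTuple z (z i)) m k

/-- The Newton basis `∏ l < j, (X - z l)`, `j < k`. -/
noncomputable def newtonBasis (z : Fin k → ℂ) (j : Fin k) (w : ℂ) : ℂ :=
  ∏ l ∈ Finset.Iio j, (w - z l)

/-- The derivative of `∏ l, (X - z l)` at `z i`. -/
def nodeDeriv (z : Fin k → ℂ) (i : Fin k) : ℂ :=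
  ∏ l ∈ Finset.univ.erase i, (z i - z l)

theorem extendTuple_val (z : Fin k → ℂ) (w : ℂ) (i : Fin k) : extendTuple z w i = z i :=
  dif_pos i.isLt

theorem extendTuple_self (z : Fin k → ℂ) (w : ℂ) : extendTuple z w k = w :=
  dif_neg (lt_irrefl k)

theorem pow_eq_sum_newtonMatrix_add (z : Fin k → ℂ) (w : ℂ) (m : ℕ) :
    w ^ m = ∑ j, newtonBasis z j w * newtonMatrix z j m +
      newtonCoeff (extendTuple z w) m k * ∏ l, (w - z l) := by
  have hcoeff (j : Fin k) : newtonCoeff (extendTuple z w) m j = newtonMatrix z j m :=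
    newtonCoeff_congr (fun i hi => by simp only [extendTuple, hi.trans_lt j.isLt, dif_pos]) m
  have hbasis (j : Fin k) :
      ∏ i ∈ Finset.range j, (w - extendTuple z w i) = newtonBasis z j w := by
    rw [newtonBasis, ← Nat.Iio_eq_range, ← Fin.map_valEmbedding_Iio, Finset.prod_map]
    exact Finset.prod_congr rfl fun l _ => by rw [Fin.valEmbedding_apply, extendTuple_val]
  have hnewton := pow_eq_sum_newtonCoeff_mul_prod (extendTuple z w) m k
  rw [extendTuple_self, Finset.sum_range_succ, Finset.prod_range, Finset.sum_range] at hnewton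
  simpa only [hcoeff, hbasis, extendTuple_val, mul_comm (newtonBasis z _ w)] using hnewton

theorem newtonBasis_eq_zero {z : Fin k → ℂ} {i j : Fin k} (h : i < j) :
    newtonBasis z j (z i) = 0 :=
  Finset.prod_eq_zero (Finset.mem_Iio.2 h) (sub_self _)

theorem evalMatrix_pow_eq_mul_newtonMatrix (z : Fin k → ℂ) :
    evalMatrix (fun (m : ℕ) w => w ^ m) z = evalMatrix (newtonBasis z) z * newtonMatrix z := by
  ext i m
  rw [Matrix.mul_apply]
  refine (pow_eq_sum_newtonMatrix_add z (z i) m).trans ?_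
  rw [Finset.prod_eq_zero (Finset.mem_univ i) (sub_self _), mul_zero, add_zero]
  rfl

theorem continuous_extendTuple :
    Continuous fun p : (Fin k → ℂ) × ℂ => extendTuple p.1 p.2 := by
  refine continuous_pi fun i => ?_
  by_cases h : i < k
  · simpa only [extendTuple, dif_pos h] using (continuous_apply (⟨i, h⟩ : Fin k)).fst'
  · simpa only [extendTuple, dif_neg h] using continuous_snd

theorem hasDerivAt_prod_sub (z : Fin k → ℂ) (i : Fin k) :
    HasDerivAt (fun w => ∏ l, (w - z l)) (nodeDeriv z i) (z i) := by
  refine (HasDerivAt.fun_finsetProd (u := Finset.univ) (f := fun l w => w - z l)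
    (f' := fun _ => (1 : ℂ)) fun l _ => (hasDerivAt_id (z i)).sub_const (z l)).congr_deriv ?_
  rw [Finset.sum_eq_single i]
  · simp [nodeDeriv]
  · intro j _ hj
    rw [Finset.prod_eq_zero (Finset.mem_erase.2 ⟨hj.symm, Finset.mem_univ i⟩) (sub_self _),
      zero_smul]
  · simp

theorem differentiable_newtonBasis (z : Fin k → ℂ) (j : Fin k) :
    Differentiable ℂ (newtonBasis z j) := by
  unfold newtonBasis
  fun_prop

theorem evalMatrix_deriv_pow_eq_add (z : Fin k → ℂ) :
    evalMatrix (fun (m : ℕ) => deriv fun w => w ^ m) z =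
      evalMatrix (fun j => deriv (newtonBasis z j)) z * newtonMatrix z +
        Matrix.diagonal (nodeDeriv z) * newtonQuotient z := by
  ext i m
  have hbasis (j : Fin k) :=
    (differentiable_newtonBasis z j (z i)).hasDerivAt.mul_const (newtonMatrix z j m)
  have hquot : ContinuousAt (fun w => newtonCoeff (extendTuple z w) m k) (z i) :=
    ((continuous_newtonCoeff m k).comp
      (continuous_extendTuple.comp (Continuous.prodMk_right z))).continuousAt
  have hrem := (hasFDerivAt_mul_of_eq_zero hquot (hasDerivAt_prod_sub z i).hasFDerivAt
    (Finset.prod_eq_zero (Finset.mem_univ i) (sub_self _))).hasDerivAt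
  have hpow := (HasDerivAt.fun_sum (u := Finset.univ) fun j _ => hbasis j).add hrem
  rw [Matrix.add_apply, Matrix.mul_apply, Matrix.diagonal_mul]
  refine (hpow.congr_of_eventuallyEq
    (.of_forall fun w => pow_eq_sum_newtonMatrix_add z w m)).deriv.trans ?_
  simp [evalMatrix, newtonQuotient, mul_comm]

theorem det_evalMatrix_newtonBasis (z : Fin k → ℂ) :
    (evalMatrix (newtonBasis z) z).det = ∏ i, ∏ l ∈ Finset.Iio i, (z i - z l) :=
  Matrix.det_of_isLowerTriangular _ fun _ _ h => newtonBasis_eq_zero h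

theorem norm_det_evalMatrix_newtonBasis_sq (z : Fin k → ℂ) :
    ‖(evalMatrix (newtonBasis z) z).det‖ ^ 2 = ∏ i, ‖nodeDeriv z i‖ := by
  have hsplit (i : Fin k) : ‖nodeDeriv z i‖ =
      (∏ l ∈ Finset.Iio i, ‖z i - z l‖) * ∏ l ∈ Finset.Ioi i, ‖z i - z l‖ := by
    rw [nodeDeriv, norm_prod, ← Finset.prod_union (Finset.disjoint_left.2 fun l hl hl' =>
      lt_asymm (Finset.mem_Iio.1 hl) (Finset.mem_Ioi.1 hl'))]
    refine Finset.prod_congr ?_ fun _ _ => rfl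
    ext l
    simp [lt_or_lt_iff_ne]
  have hswap : ∏ i, ∏ l ∈ Finset.Ioi i, ‖z i - z l‖ = ∏ i, ∏ l ∈ Finset.Iio i, ‖z i - z l‖ := by
    rw [Finset.prod_comm' (t' := Finset.univ) (s' := fun l => Finset.Iio l) (by simp)]
    exact Finset.prod_congr rfl fun _ _ => Finset.prod_congr rfl fun _ _ => norm_sub_rev _ _
  simp only [hsplit, Finset.prod_mul_distrib, hswap, det_evalMatrix_newtonBasis, norm_prod, sq]

theorem nodeDeriv_ne_zero {z : Fin k → ℂ} (hz : Function.Injective z) (i : Fin k) :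
    nodeDeriv z i ≠ 0 :=
  Finset.prod_ne_zero_iff.2 fun _ hl => sub_ne_zero.2 (hz.ne (Finset.ne_of_mem_erase hl).symm)

theorem prod_norm_nodeDeriv_eq_zero {z : Fin k → ℂ} (hz : ¬ Function.Injective z) :
    ∏ i, ‖nodeDeriv z i‖ = 0 := by
  obtain ⟨i, l, hil, hne⟩ := Function.not_injective_iff.1 hz
  refine Finset.prod_eq_zero (Finset.mem_univ i) (norm_eq_zero.2 ?_)
  exact Finset.prod_eq_zero (Finset.mem_erase.2 ⟨hne.symm, Finset.mem_univ l⟩) (sub_eq_zero.2 hil)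

end NewtonMatrices

section LocallyUniformConvergence

theorem continuousWithinAt_of_forall_tendsto_prod {X ι β : Type*} [TopologicalSpace X]
    [TopologicalSpace β] [RegularSpace β] {F : ι → X → β} {f : X → β} {p : Filter ι} [p.NeBot]
    {s : Set X} (h : ∀ x ∈ s, Tendsto (fun q : ι × X => F q.1 q.2) (p ×ˢ 𝓝[s] x) (𝓝 (f x)))
    {x : X} (hx : x ∈ s) : ContinuousWithinAt f s x := by
  refine (closed_nhds_basis (f x)).tendsto_right_iff.2 fun U ⟨hU, hUclosed⟩ => ?_
  have hFU := (eventually_swap_iff.1 ((h x hx).eventually hU)).curry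
  filter_upwards [self_mem_nhdsWithin, hFU] with x' hx' hUx'
  exact hUclosed.mem_of_tendsto ((h x' hx').comp
    (tendsto_id.prodMk (tendsto_const_pure.mono_right (pure_le_nhdsWithin hx')))) hUx'

theorem tendstoLocallyUniformlyOn_of_forall_tendsto_prod {X ι β : Type*} [TopologicalSpace X]
    [UniformSpace β] {F : ι → X → β} {f : X → β} {p : Filter ι} [p.NeBot] {s : Set X}
    (h : ∀ x ∈ s, Tendsto (fun q : ι × X => F q.1 q.2) (p ×ˢ 𝓝[s] x) (𝓝 (f x))) :
    TendstoLocallyUniformlyOn F f p s :=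
  tendstoLocallyUniformlyOn_iff_forall_tendsto.2 fun x hx =>
    (((continuousWithinAt_of_forall_tendsto_prod h hx).tendsto.comp tendsto_snd).prodMk_nhds
      (h x hx)).mono_right (nhds_le_uniformity _)

end LocallyUniformConvergence

section GramMatrices

open scoped Matrix ComplexOrder

variable {κ : Type*}

/-- The first `n` columns of a matrix with columns indexed by `ℕ`. -/
def truncateCols (n : ℕ) (M : Matrix κ ℕ ℂ) : Matrix κ (Fin n) ℂ := M.submatrix id Fin.val

theorem truncateCols_mul_conjTranspose_apply (n : ℕ) (M N : Matrix κ ℕ ℂ) (i j : κ) :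
    (truncateCols n M * (truncateCols n N)ᴴ) i j =
      ∑ l ∈ Finset.range n, M i l * conj (N j l) := by
  rw [Finset.sum_range]
  rfl

theorem truncateCols_mul [Fintype κ] (n : ℕ) (Λ : Matrix κ κ ℂ) (M : Matrix κ ℕ ℂ) :
    truncateCols n (Λ * M) = Λ * truncateCols n M := rfl

theorem tendsto_truncateCols_mul_conjTranspose {M N : Matrix κ ℕ ℂ} {A : Matrix κ κ ℂ}
    (h : ∀ i j, HasSum (fun l => M i l * conj (N j l)) (A i j)) :
    Tendsto (fun n => truncateCols n M * (truncateCols n N)ᴴ) atTop (𝓝 A) :=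
  tendsto_pi_nhds.2 fun i => tendsto_pi_nhds.2 fun j => by
    simpa only [truncateCols_mul_conjTranspose_apply] using (h i j).tendsto_sum_nat

theorem tendsto_truncateCols_mul_conjTranspose_prod {X : Type*} [TopologicalSpace X] {x₀ : X}
    {M N : X → Matrix κ ℕ ℂ} (hM : ContinuousAt M x₀) (hN : ContinuousAt N x₀) {b : ℕ → ℝ}
    (hb : Summable b) (hMb : ∀ᶠ x in 𝓝 x₀, ∀ i l, ‖M x i l‖ ^ 2 ≤ b l)
    (hNb : ∀ᶠ x in 𝓝 x₀, ∀ i l, ‖N x i l‖ ^ 2 ≤ b l) :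
    Tendsto (fun p : ℕ × X => truncateCols p.1 (M p.2) * (truncateCols p.1 (N p.2))ᴴ)
      (atTop ×ˢ 𝓝 x₀) (𝓝 (Matrix.of fun i j => ∑' l, M x₀ i l * conj (N x₀ j l))) := by
  refine tendsto_pi_nhds.2 fun i => tendsto_pi_nhds.2 fun j => ?_
  simp only [truncateCols_mul_conjTranspose_apply, Matrix.of_apply]
  refine (tendsto_tsum_of_dominated_convergence hb (fun l => ?_) ?_).congr fun p =>
    (sum_eq_tsum_indicator (fun l => M p.2 i l * conj (N p.2 j l)) _).symm
  · have hl : ∀ᶠ p : ℕ × X in atTop ×ˢ 𝓝 x₀, l ∈ (Finset.range p.1 : Set ℕ) := by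
      filter_upwards [tendsto_fst.eventually (eventually_gt_atTop l)] with p hp using by simpa
    have hMl := ((continuous_apply_apply i l).continuousAt.comp hM).tendsto.comp
      (tendsto_snd (f := (atTop : Filter ℕ)))
    have hNl := ((continuous_apply_apply j l).continuousAt.comp hN).tendsto.comp
      (tendsto_snd (f := (atTop : Filter ℕ)))
    refine (hMl.mul ((Complex.continuous_conj.tendsto _).comp hNl)).congr' ?_
    filter_upwards [hl] with p hp
    rw [Set.indicator_of_mem hp]
    rfl
  · filter_upwards [tendsto_snd.eventually hMb, tendsto_snd.eventually hNb] with p hMp hNp l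
    refine (norm_indicator_le_norm_self _ _).trans ?_
    rw [norm_mul, RCLike.norm_conj]
    nlinarith [hMp i l, hNp j l, sq_nonneg (‖M p.2 i l‖ - ‖N p.2 j l‖)]

variable [Fintype κ] [DecidableEq κ]

theorem eq_zero_of_conjTranspose_mulVec_eq_zero {ι : Type*} {M : Matrix κ ι ℂ} {e : κ → ι}
    (he : (M.submatrix id e).det ≠ 0) {x : κ → ℂ} (hx : Mᴴ *ᵥ x = 0) : x = 0 :=
  Matrix.eq_zero_of_mulVec_eq_zero (M := (M.submatrix id e)ᴴ)
    (by rwa [Matrix.det_conjTranspose, star_ne_zero]) (funext fun i => congrFun hx (e i))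

theorem det_mul_conjTranspose_ne_zero {ι : Type*} [Fintype ι] {M : Matrix κ ι ℂ} {e : κ → ι}
    (he : (M.submatrix id e).det ≠ 0) : (M * Mᴴ).det ≠ 0 := fun h => by
  obtain ⟨x, hx, hx0⟩ := Matrix.exists_mulVec_eq_zero_iff.2 h
  exact hx (eq_zero_of_conjTranspose_mulVec_eq_zero he
    ((Matrix.self_mul_conjTranspose_mulVec_eq_zero M x).1 hx0))

theorem det_ne_zero_of_tendsto_truncateCols {M : Matrix κ ℕ ℂ} {e : κ → ℕ}
    (he : (M.submatrix id e).det ≠ 0) {A : Matrix κ κ ℂ}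
    (hA : Tendsto (fun n => truncateCols n M * (truncateCols n M)ᴴ) atTop (𝓝 A)) :
    A.det ≠ 0 := fun h => by
  obtain ⟨x, hx, hx0⟩ := Matrix.exists_mulVec_eq_zero_iff.2 h
  refine hx (eq_zero_of_conjTranspose_mulVec_eq_zero he (funext fun l => ?_))
  have hquad (n : ℕ) : ((∑ l ∈ Finset.range n, ‖(Mᴴ *ᵥ x) l‖ ^ 2 : ℝ) : ℂ) =
      star x ⬝ᵥ (truncateCols n M * (truncateCols n M)ᴴ) *ᵥ x := by
    rw [Finset.sum_range]
    have h := sum_norm_sq_mulVec (truncateCols n M)ᴴ x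
    rwa [Matrix.conjTranspose_conjTranspose] at h
  have hlim : Tendsto (fun n => ∑ l ∈ Finset.range n, ‖(Mᴴ *ᵥ x) l‖ ^ 2) atTop (𝓝 0) := by
    have hcont : Continuous fun B : Matrix κ κ ℂ => star x ⬝ᵥ B *ᵥ x := by fun_prop
    have h := (hcont.tendsto A).comp hA
    simp only [Function.comp_def, ← hquad, hx0, dotProduct_zero] at h
    exact tendsto_ofReal_iff.1 h
  have hle : ‖(Mᴴ *ᵥ x) l‖ ^ 2 ≤ 0 := by
    refine ge_of_tendsto hlim ((eventually_gt_atTop l).mono fun n hn => ?_)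
    exact Finset.single_le_sum (f := fun l => ‖(Mᴴ *ᵥ x) l‖ ^ 2) (fun _ _ => by positivity)
      (Finset.mem_range.2 hn)
  exact norm_eq_zero.1 (pow_eq_zero_iff two_ne_zero |>.1 (le_antisymm hle (by positivity)))

theorem tendsto_zeroIntensity {α : Type*} {p : Filter α} {A B C : α → Matrix κ κ ℂ}
    {A₀ B₀ C₀ : Matrix κ κ ℂ} (hA : Tendsto A p (𝓝 A₀)) (hB : Tendsto B p (𝓝 B₀))
    (hC : Tendsto C p (𝓝 C₀)) (h : A₀.det ≠ 0) :
    Tendsto (fun x => zeroIntensity (A x) (B x) (C x)) p (𝓝 (zeroIntensity A₀ B₀ C₀)) := by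
  have hper : Continuous (Matrix.permanent : Matrix κ κ ℂ → ℂ) := by
    unfold Matrix.permanent
    fun_prop
  have hinv := (continuousAt_matrix_inv A₀
    (by rw [Ring.inverse_eq_inv']; exact continuousAt_inv₀ h)).tendsto.comp hA
  have hBstar := (continuous_id.matrix_conjTranspose.tendsto B₀).comp hB
  refine ((hper.tendsto _).comp (hC.sub ((hB.mul hinv).mul hBstar))).div
    ((continuous_id.matrix_det.tendsto _).comp (hA.const_smul (Real.pi : ℂ))) ?_
  change (_ • A₀).det ≠ 0
  rw [Matrix.det_smul]
  exact mul_ne_zero (pow_ne_zero _ (Complex.ofReal_ne_zero.2 Real.pi_ne_zero)) h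

end GramMatrices

section KacIntensity

open scoped Matrix ComplexOrder

variable {k n : ℕ} {z : Fin k → ℂ}

/-- The matrix of values at the `z i` of the monomials `1, X, X ^ 2, …`. -/
noncomputable def monomialMatrix (z : Fin k → ℂ) : Matrix (Fin k) ℕ ℂ :=
  evalMatrix (fun m w => w ^ m) z

/-- The matrix of values at the `z i` of the derivatives of the monomials `1, X, X ^ 2, …`. -/
noncomputable def monomialDerivMatrix (z : Fin k → ℂ) : Matrix (Fin k) ℕ ℂ :=
  evalMatrix (fun m => deriv fun w => w ^ m) z

/-- The `k`-point intensity of the zeros of `∑ l < n, a l * X ^ l` with Gaussian coefficients,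
written in terms of divided differences so as to make sense at coinciding points. -/
noncomputable def kacIntensity (n : ℕ) (z : Fin k → ℂ) : ℝ :=
  (∏ i, ‖nodeDeriv z i‖) *
    (gramZeroIntensity (truncateCols n (newtonMatrix z)) (truncateCols n (newtonQuotient z))).re

theorem det_submatrix_newtonMatrix (z : Fin k → ℂ) :
    ((newtonMatrix z).submatrix id Fin.val).det = 1 := by
  rw [Matrix.det_of_isUpperTriangular]
  · exact Finset.prod_eq_one fun j _ => newtonCoeff_self _ _
  · exact fun i j h => newtonCoeff_eq_zero_of_lt _ h

theorem det_newtonMatrix_mul_conjTranspose_ne_zero (hn : k ≤ n) (z : Fin k → ℂ) :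
    (truncateCols n (newtonMatrix z) * (truncateCols n (newtonMatrix z))ᴴ).det ≠ 0 :=
  det_mul_conjTranspose_ne_zero (e := Fin.castLE hn)
    ((det_submatrix_newtonMatrix z).trans_ne one_ne_zero)

theorem kacIntensity_eq_zero (hz : ¬ Function.Injective z) :
    kacIntensity n z = 0 := by
  rw [kacIntensity, prod_norm_nodeDeriv_eq_zero hz, zero_mul]

theorem kacIntensity_nonneg (hn : k ≤ n) (z : Fin k → ℂ) : 0 ≤ kacIntensity n z :=
  mul_nonneg (by positivity) (Complex.nonneg_iff.1 (gramZeroIntensity_nonneg _ _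
    (det_newtonMatrix_mul_conjTranspose_ne_zero hn z))).1

theorem ofReal_kacIntensity (hn : k ≤ n) (z : Fin k → ℂ) :
    (kacIntensity n z : ℂ) = ((∏ i, ‖nodeDeriv z i‖ : ℝ) : ℂ) *
      gramZeroIntensity (truncateCols n (newtonMatrix z)) (truncateCols n (newtonQuotient z)) := by
  rw [kacIntensity, Complex.ofReal_mul, ← Complex.eq_re_of_ofReal_le (r := 0)
    (gramZeroIntensity_nonneg _ _ (det_newtonMatrix_mul_conjTranspose_ne_zero hn z))]

theorem det_evalMatrix_newtonBasis_ne_zero (hz : Function.Injective z) :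
    (evalMatrix (newtonBasis z) z).det ≠ 0 := fun h => by
  have hsq := norm_det_evalMatrix_newtonBasis_sq z
  rw [h, norm_zero, sq, zero_mul] at hsq
  exact Finset.prod_ne_zero_iff.2 (fun i _ => norm_ne_zero_iff.2 (nodeDeriv_ne_zero hz i)) hsq.symm

theorem ofReal_kacIntensity_eq_gramZeroIntensity (hn : k ≤ n) (hz : Function.Injective z) :
    (kacIntensity n z : ℂ) =
      gramZeroIntensity (truncateCols n (monomialMatrix z))
        (truncateCols n (monomialDerivMatrix z)) := by
  have hderiv : truncateCols n (monomialDerivMatrix z) =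
      evalMatrix (fun j => deriv (newtonBasis z j)) z * truncateCols n (newtonMatrix z) +
        Matrix.diagonal (nodeDeriv z) * truncateCols n (newtonQuotient z) := by
    rw [monomialDerivMatrix, evalMatrix_deriv_pow_eq_add]
    rfl
  have hweight : (∏ i, ‖nodeDeriv z i‖ ^ 2) / ‖(evalMatrix (newtonBasis z) z).det‖ ^ 2 =
      ∏ i, ‖nodeDeriv z i‖ := by
    have hpos : ∏ i, ‖nodeDeriv z i‖ ≠ 0 :=
      Finset.prod_ne_zero_iff.2 fun i _ => norm_ne_zero_iff.2 (nodeDeriv_ne_zero hz i)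
    rw [norm_det_evalMatrix_newtonBasis_sq, Finset.prod_pow, sq, mul_div_cancel_right₀ _ hpos]
  rw [monomialMatrix, evalMatrix_pow_eq_mul_newtonMatrix, truncateCols_mul, hderiv,
    gramZeroIntensity_mul_add _ _ _ _ _ (det_evalMatrix_newtonBasis_ne_zero hz)
      (det_newtonMatrix_mul_conjTranspose_ne_zero hn z), hweight, ofReal_kacIntensity hn]

theorem continuous_newtonMatrix : Continuous (newtonMatrix : (Fin k → ℂ) → Matrix (Fin k) ℕ ℂ) :=
  continuous_matrix fun j m => (continuous_newtonCoeff m j).comp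
    (continuous_extendTuple.comp (continuous_id.prodMk continuous_const))

theorem continuous_newtonQuotient :
    Continuous (newtonQuotient : (Fin k → ℂ) → Matrix (Fin k) ℕ ℂ) :=
  continuous_matrix fun i m => (continuous_newtonCoeff m k).comp
    (continuous_extendTuple.comp (continuous_id.prodMk (continuous_apply i)))

theorem continuous_prod_norm_nodeDeriv :
    Continuous fun z : Fin k → ℂ => ∏ i, ‖nodeDeriv z i‖ := by
  unfold nodeDeriv
  fun_prop

theorem continuous_kacIntensity (hn : k ≤ n) : Continuous (kacIntensity n : (Fin k → ℂ) → ℝ) := by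
  have hW : Continuous fun z : Fin k → ℂ => truncateCols n (newtonMatrix z) :=
    continuous_newtonMatrix.matrix_submatrix _ _
  have hQ : Continuous fun z : Fin k → ℂ => truncateCols n (newtonQuotient z) :=
    continuous_newtonQuotient.matrix_submatrix _ _
  refine continuous_prod_norm_nodeDeriv.mul
    (Complex.continuous_re.comp (continuous_iff_continuousAt.2 fun z => ?_))
  exact tendsto_zeroIntensity ((hW.matrix_mul hW.matrix_conjTranspose).tendsto z)
    ((hQ.matrix_mul hW.matrix_conjTranspose).tendsto z)
    ((hQ.matrix_mul hQ.matrix_conjTranspose).tendsto z)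
    (det_newtonMatrix_mul_conjTranspose_ne_zero hn z)

theorem norm_newtonCoeff_extendTuple_le {r ε : ℝ} (hr : 0 ≤ r) (hε : 0 < ε) (hε1 : ε ≤ 1)
    (hz : ∀ i, ‖z i‖ ≤ r) {w : ℂ} (hw : ‖w‖ ≤ r) {j : ℕ} (hj : j ≤ k) (m : ℕ) :
    ‖newtonCoeff (extendTuple z w) m j‖ ≤ (r + ε) ^ m / ε ^ k := by
  have hx (i : ℕ) : ‖extendTuple z w i‖ ≤ r := by
    rw [extendTuple]
    split_ifs
    exacts [hz _, hw]
  exact (norm_newtonCoeff_le hε hx m j).trans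
    (div_le_div_of_nonneg_left (by positivity) (by positivity) (pow_le_pow_of_le_one hε.le hε1 hj))

theorem exists_summable_bound_newton (hz : ∀ i, ‖z i‖ < 1) :
    ∃ b : ℕ → ℝ, Summable b ∧ ∀ᶠ x in 𝓝 z, ∀ (i : Fin k) (m : ℕ),
      ‖newtonMatrix x i m‖ ^ 2 ≤ b m ∧ ‖newtonQuotient x i m‖ ^ 2 ≤ b m := by
  obtain ⟨r, hzr, hr1⟩ := exists_between ((pi_norm_lt_iff one_pos).2 hz)
  have hr0 : 0 ≤ r := (norm_nonneg z).trans hzr.le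
  obtain ⟨ε, hε, hrε⟩ := exists_between (sub_pos.2 hr1)
  have hθ : (r + ε) ^ 2 < 1 := by nlinarith
  refine ⟨fun m => ((r + ε) ^ m / ε ^ k) ^ 2, ?_, ?_⟩
  · simp only [div_pow, ← pow_mul, mul_comm _ 2]
    simp only [pow_mul]
    exact (summable_geometric_of_lt_one (by positivity) hθ).div_const _
  · filter_upwards [(continuous_norm.tendsto z).eventually (gt_mem_nhds hzr)] with x hx i m
    have hxr (l : Fin k) : ‖x l‖ ≤ r := (norm_le_pi_norm x l).trans hx.le
    constructor <;> gcongr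
    · exact norm_newtonCoeff_extendTuple_le hr0 hε (by linarith) hxr (by simpa) i.isLt.le m
    · exact norm_newtonCoeff_extendTuple_le hr0 hε (by linarith) hxr (hxr i) le_rfl m

theorem hasSum_pow_mul_pow {z w : ℂ} (h : ‖z * w‖ < 1) :
    HasSum (fun m : ℕ => z ^ m * w ^ m) (hInf (z * w)) := by
  simpa only [hInf, one_div, mul_pow] using hasSum_geometric_of_norm_lt_one h

theorem hasSum_succ_mul_pow {x : ℂ} (h : ‖x‖ < 1) :
    HasSum (fun m : ℕ => ((m : ℂ) + 1) * x ^ m) (gInf x) := by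
  simpa [gInf] using hasSum_choose_mul_geometric_of_norm_lt_one 1 h

theorem hasSum_succ_sq_mul_pow {x : ℂ} (h : ‖x‖ < 1) :
    HasSum (fun m : ℕ => ((m : ℂ) + 1) ^ 2 * x ^ m) (gInf x + x * fInf x) := by
  have hx : (1 : ℂ) - x ≠ 0 := sub_ne_zero.2 fun hx => by simp [← hx] at h
  have hterm (m : ℕ) : ((m : ℂ) + 1) ^ 2 * x ^ m =
      2 * ((m + 2).choose 2 * x ^ m) - (m + 1) * x ^ m := by
    rw [Nat.cast_choose_two]
    push_cast
    ring
  have hvalue : gInf x + x * fInf x = 2 * (1 / (1 - x) ^ (2 + 1)) - gInf x := by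
    rw [gInf, fInf]
    field_simp
    ring
  rw [hvalue, funext hterm]
  exact ((hasSum_choose_mul_geometric_of_norm_lt_one 2 h).mul_left 2).sub (hasSum_succ_mul_pow h)

theorem hasSum_derivPow_mul_pow {z w : ℂ} (h : ‖z * w‖ < 1) :
    HasSum (fun m : ℕ => (m : ℂ) * z ^ (m - 1) * w ^ m) (w * gInf (z * w)) := by
  rw [← hasSum_nat_add_iff' 1]
  convert! (hasSum_succ_mul_pow h).mul_left w using 1
  · funext m
    rw [Nat.add_sub_cancel]
    push_cast
    ring
  · simp

theorem hasSum_derivPow_mul_derivPow {z w : ℂ} (h : ‖z * w‖ < 1) :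
    HasSum (fun m : ℕ => (m : ℂ) * z ^ (m - 1) * (m * w ^ (m - 1)))
      (gInf (z * w) + z * w * fInf (z * w)) := by
  rw [← hasSum_nat_add_iff' 1]
  convert! hasSum_succ_sq_mul_pow h using 1
  · funext m
    rw [Nat.add_sub_cancel]
    push_cast
    ring
  · simp

theorem norm_mul_conj_lt_one {ι : Type*} {z : ι → ℂ} (hz : ∀ i, ‖z i‖ < 1) (i j : ι) :
    ‖z i * conj (z j)‖ < 1 := by
  rw [norm_mul, RCLike.norm_conj]
  exact mul_lt_one_of_nonneg_of_lt_one_left (norm_nonneg _) (hz i) (hz j).le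

theorem tendsto_monomialMatrix_mul_conjTranspose (hz : ∀ i, ‖z i‖ < 1) :
    Tendsto (fun n => truncateCols n (monomialMatrix z) * (truncateCols n (monomialMatrix z))ᴴ)
      atTop (𝓝 (covA z)) :=
  tendsto_truncateCols_mul_conjTranspose fun i j => by
    simpa [monomialMatrix, evalMatrix, covA] using
      hasSum_pow_mul_pow (norm_mul_conj_lt_one hz i j)

theorem tendsto_monomialDerivMatrix_mul_conjTranspose_monomialMatrix (hz : ∀ i, ‖z i‖ < 1) :
    Tendsto (fun n => truncateCols n (monomialDerivMatrix z) *
      (truncateCols n (monomialMatrix z))ᴴ) atTop (𝓝 (covB z)) :=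
  tendsto_truncateCols_mul_conjTranspose fun i j => by
    simpa [monomialMatrix, monomialDerivMatrix, evalMatrix, covB] using
      hasSum_derivPow_mul_pow (norm_mul_conj_lt_one hz i j)

theorem tendsto_monomialDerivMatrix_mul_conjTranspose (hz : ∀ i, ‖z i‖ < 1) :
    Tendsto (fun n => truncateCols n (monomialDerivMatrix z) *
      (truncateCols n (monomialDerivMatrix z))ᴴ) atTop (𝓝 (covC z)) :=
  tendsto_truncateCols_mul_conjTranspose fun i j => by
    simpa [monomialDerivMatrix, evalMatrix, covC] using
      hasSum_derivPow_mul_derivPow (norm_mul_conj_lt_one hz i j)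

theorem det_covA_ne_zero (hz : ∀ i, ‖z i‖ < 1) (hinj : Function.Injective z) :
    (covA z).det ≠ 0 := by
  refine det_ne_zero_of_tendsto_truncateCols (e := Fin.val) ?_
    (tendsto_monomialMatrix_mul_conjTranspose hz)
  exact Matrix.det_vandermonde_ne_zero_iff.2 hinj

theorem tendsto_kacIntensity_of_injective (hz : ∀ i, ‖z i‖ < 1) (hinj : Function.Injective z) :
    Tendsto (fun n => (kacIntensity n z : ℂ)) atTop (𝓝 (rhoInf k z)) := by
  have h := tendsto_zeroIntensity (tendsto_monomialMatrix_mul_conjTranspose hz)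
    (tendsto_monomialDerivMatrix_mul_conjTranspose_monomialMatrix hz)
    (tendsto_monomialDerivMatrix_mul_conjTranspose hz) (det_covA_ne_zero hz hinj)
  rw [rhoInf, if_pos hinj]
  refine h.congr' ?_
  filter_upwards [eventually_ge_atTop k] with n hn
  exact (ofReal_kacIntensity_eq_gramZeroIntensity hn hinj).symm

theorem exists_tendsto_gramZeroIntensity_newton (hz : ∀ i, ‖z i‖ < 1) :
    ∃ L, Tendsto (fun p : ℕ × (Fin k → ℂ) => gramZeroIntensity
      (truncateCols p.1 (newtonMatrix p.2)) (truncateCols p.1 (newtonQuotient p.2)))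
      (atTop ×ˢ 𝓝 z) (𝓝 L) := by
  obtain ⟨b, hb, hbound⟩ := exists_summable_bound_newton hz
  have hWb := hbound.mono fun x hx i m => (hx i m).1
  have hQb := hbound.mono fun x hx i m => (hx i m).2
  have hW := continuous_newtonMatrix.continuousAt (x := z)
  have hQ := continuous_newtonQuotient.continuousAt (x := z)
  have hgram := tendsto_truncateCols_mul_conjTranspose_prod hW hW hb hWb hWb
  have hdet := det_ne_zero_of_tendsto_truncateCols (e := Fin.val)
    ((det_submatrix_newtonMatrix z).trans_ne one_ne_zero)
    (hgram.comp (tendsto_id.prodMk tendsto_const_nhds))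
  exact ⟨_, tendsto_zeroIntensity hgram
    (tendsto_truncateCols_mul_conjTranspose_prod hQ hW hb hQb hWb)
    (tendsto_truncateCols_mul_conjTranspose_prod hQ hQ hb hQb hQb) hdet⟩

theorem tendsto_kacIntensity (hz : ∀ i, ‖z i‖ < 1) :
    Tendsto (fun p : ℕ × (Fin k → ℂ) => (kacIntensity p.1 p.2 : ℂ)) (atTop ×ˢ 𝓝 z)
      (𝓝 (rhoInf k z)) := by
  obtain ⟨L, hL⟩ := exists_tendsto_gramZeroIntensity_newton hz
  have hweight := (Complex.continuous_ofReal.comp continuous_prod_norm_nodeDeriv).tendsto z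
  have hlim : Tendsto (fun p : ℕ × (Fin k → ℂ) => (kacIntensity p.1 p.2 : ℂ)) (atTop ×ˢ 𝓝 z)
      (𝓝 (((∏ i, ‖nodeDeriv z i‖ : ℝ) : ℂ) * L)) := by
    refine ((hweight.comp tendsto_snd).mul hL).congr' ?_
    filter_upwards [tendsto_fst.eventually (eventually_ge_atTop k)] with p hp
    exact (ofReal_kacIntensity hp p.2).symm
  suffices hvalue : ((∏ i, ‖nodeDeriv z i‖ : ℝ) : ℂ) * L = rhoInf k z from hvalue ▸ hlim
  by_cases hinj : Function.Injective z
  · exact tendsto_nhds_unique (hlim.comp (tendsto_id.prodMk tendsto_const_nhds))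
      (tendsto_kacIntensity_of_injective hz hinj)
  · rw [prod_norm_nodeDeriv_eq_zero hinj, Complex.ofReal_zero, zero_mul, rhoInf, if_neg hinj]

theorem isCompact_setOf_forall_norm_le (ι : Type*) (y : ℝ) :
    IsCompact {z : ι → ℂ | ∀ i, ‖z i‖ ≤ y} := by
  simpa [Set.pi, Metric.closedBall] using
    isCompact_univ_pi fun _ : ι => isCompact_closedBall (0 : ℂ) y

theorem tendstoUniformlyOn_kacIntensity (k : ℕ) {y : ℝ} (hy : y < 1) :
    TendstoUniformlyOn (fun n z => (kacIntensity n z : ℂ)) (rhoInf k) atTop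
      {z | ∀ i, ‖z i‖ ≤ y} :=
  (tendstoLocallyUniformlyOn_iff_tendstoUniformlyOn_of_compact
    (isCompact_setOf_forall_norm_le _ y)).1 <|
    tendstoLocallyUniformlyOn_of_forall_tendsto_prod fun _ hz =>
      (tendsto_kacIntensity fun i => (hz i).trans_lt hy).mono_left
        (prod_mono_right _ nhdsWithin_le_nhds)

end KacIntensity

section SimpleZeros

open scoped Matrix

variable {κ ν : Type*} [Fintype κ] [DecidableEq κ] [Fintype ν]
  {φ : κ ⊕ ν → ℂ → ℂ}

theorem ae_forall_evalMatrix_deriv_mulVec_ne_zero (hφ : ∀ l, Differentiable ℂ (φ l)) :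
    ∀ᵐ a, ∀ z : κ → ℂ, (evalMatrix φ z).toCols₁.det ≠ 0 → evalMatrix φ z *ᵥ a = 0 →
      ∀ i, (evalMatrix (fun l => deriv (φ l)) z *ᵥ a) i ≠ 0 := by
  classical
  filter_upwards [ae_forall_det_ne_zero volume
    (s := {c | (evalMatrix φ (c ∘ Sum.inl)).toCols₁.det ≠ 0})
    fun c hc => (hasFDerivAt_zeroCoeffs hφ hc).hasFDerivWithinAt] with a ha z hz hza i h0
  have hcoeffs : zeroCoeffs φ (Sum.elim z (a ∘ Sum.inr)) = a :=
    (zeroCoeffs_eq_iff (by simpa using hz) a).2 ⟨rfl, by simpa using hza⟩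
  refine ha (Sum.elim z (a ∘ Sum.inr)) (by simpa using hz) hcoeffs ?_
  rw [det_realMulVecCLM, norm_det_zeroCoeffsJacobian_sq, hcoeffs]
  exact div_eq_zero_iff.2 (.inl (Finset.prod_eq_zero (Finset.mem_univ i) (by simp [h0])))

end SimpleZeros

section MonomialFamily

open scoped Matrix

variable {k N n : ℕ}

/-- The monomials of degree less than `k + N`, the first `k` of them being singled out. -/
def monomialFamily (k N : ℕ) (l : Fin k ⊕ Fin N) (w : ℂ) : ℂ :=
  w ^ (finSumFinEquiv l : ℕ)

theorem differentiable_monomialFamily (l : Fin k ⊕ Fin N) :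
    Differentiable ℂ (monomialFamily k N l) :=
  differentiable_id.pow _

theorem det_toCols₁_evalMatrix_monomialFamily_ne_zero_iff {z : Fin k → ℂ} :
    (evalMatrix (monomialFamily k N) z).toCols₁.det ≠ 0 ↔ Function.Injective z :=
  Matrix.det_vandermonde_ne_zero_iff

theorem gramZeroIntensity_submatrix_equiv {κ ι ι' : Type*} [Fintype κ] [DecidableEq κ] [Fintype ι]
    [Fintype ι'] (E D : Matrix κ ι ℂ) (e : ι' ≃ ι) :
    gramZeroIntensity (E.submatrix id e) (D.submatrix id e) = gramZeroIntensity E D := by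
  simp only [gramZeroIntensity, Matrix.conjTranspose_submatrix, Matrix.submatrix_mul_equiv,
    Matrix.submatrix_id_id]

theorem gramZeroIntensity_monomialFamily {z : Fin k → ℂ} (hz : Function.Injective z) :
    gramZeroIntensity (evalMatrix (monomialFamily k N) z)
      (evalMatrix (fun l => deriv (monomialFamily k N l)) z) = kacIntensity (k + N) z :=
  (gramZeroIntensity_submatrix_equiv (truncateCols (k + N) (monomialMatrix z))
    (truncateCols (k + N) (monomialDerivMatrix z)) finSumFinEquiv).trans
      (ofReal_kacIntensity_eq_gramZeroIntensity (Nat.le_add_right k N) hz).symm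

theorem evalMatrix_monomialFamily_mulVec_apply (hn : n + 1 = k + N) (a : ℕ → ℂ) (z : Fin k → ℂ)
    (i : Fin k) :
    (evalMatrix (monomialFamily k N) z *ᵥ fun l => a (finSumFinEquiv l)) i =
      (kacPolynomial n a).eval (z i) := by
  rw [kacPolynomial, Polynomial.eval_finsetSum, hn, Finset.sum_range, ← finSumFinEquiv.sum_comp]
  simp [evalMatrix, monomialFamily, Matrix.mulVec, dotProduct, mul_comm]

theorem evalMatrix_deriv_monomialFamily_mulVec_apply (hn : n + 1 = k + N) (a : ℕ → ℂ)
    (z : Fin k → ℂ) (i : Fin k) :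
    (evalMatrix (fun l => deriv (monomialFamily k N l)) z *ᵥ fun l => a (finSumFinEquiv l)) i =
      (kacPolynomial n a).derivative.eval (z i) := by
  rw [kacPolynomial, Polynomial.derivative_sum, Polynomial.eval_finsetSum, hn, Finset.sum_range,
    ← finSumFinEquiv.sum_comp]
  have hderiv (l : Fin k ⊕ Fin N) : deriv (monomialFamily k N l) (z i) =
      (finSumFinEquiv l : ℕ) * z i ^ ((finSumFinEquiv l : ℕ) - 1) :=
    (hasDerivAt_pow _ _).deriv
  simp only [evalMatrix, Matrix.mulVec, dotProduct, Matrix.of_apply, hderiv,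
    Polynomial.derivative_C_mul_X_pow, Polynomial.eval_C_mul, Polynomial.eval_pow,
    Polynomial.eval_X]
  exact Finset.sum_congr rfl fun l _ => by ring

end MonomialFamily

section DistinctRoots

theorem sumDistinct_eq_tsum {k : ℕ} {s : Multiset ℂ} (hs : s.Nodup) (φ : (Fin k → ℂ) → ℝ≥0∞) :
    sumDistinct k s φ = ∑' z : {z : Fin k → ℂ | Function.Injective z ∧ ∀ i, z i ∈ s}, φ z := by
  have hinj : Function.Injective fun x : s.ToType => x.1 := by
    rintro ⟨x, p⟩ ⟨y, q⟩ (rfl : x = y)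
    have hcount := Multiset.nodup_iff_count_le_one.1 hs x
    congr 1
    ext
    omega
  rw [sumDistinct, ← tsum_fintype (L := .unconditional _)]
  refine Equiv.tsum_eq (Equiv.ofBijective (fun e : Fin k ↪ s.ToType =>
    (⟨fun j => (e j).1, hinj.comp e.injective, fun i => Multiset.coe_mem⟩ :
      {z : Fin k → ℂ | Function.Injective z ∧ ∀ i, z i ∈ s})) ⟨fun e e' h => ?_, fun z => ?_⟩)
    fun z => φ z
  · exact DFunLike.ext _ _ fun j => hinj (congrFun (congrArg Subtype.val h) j)
  · exact ⟨⟨fun i => ⟨z.1 i, ⟨0, Multiset.count_pos.2 (z.2.2 i)⟩⟩,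
      fun i j h => z.2.1 (congrArg Sigma.fst h)⟩, rfl⟩

theorem nodup_roots_of_forall_eval_derivative_ne_zero {p : Polynomial ℂ}
    (hp : ∀ w, p.eval w = 0 → p.derivative.eval w ≠ 0) : p.roots.Nodup := by
  rcases eq_or_ne p 0 with rfl | h0
  · simp
  refine Multiset.nodup_iff_count_le_one.2 fun w => not_lt.1 fun hw => ?_
  rw [Polynomial.count_roots, Polynomial.one_lt_rootMultiplicity_iff_isRoot h0] at hw
  exact hp w hw.1 hw.2

theorem sumDistinct_roots_eq_tsum_zeros {n k N : ℕ} (hn : n + 1 = k + N) {a : ℕ → ℂ}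
    (ha : ∀ w, (kacPolynomial n a).eval w = 0 → (kacPolynomial n a).derivative.eval w ≠ 0)
    (φ : (Fin k → ℂ) → ℝ≥0∞) :
    sumDistinct k (kacPolynomial n a).roots φ =
      ∑' z : {z : Fin k → ℂ | (evalMatrix (monomialFamily k N) z).toCols₁.det ≠ 0 ∧
        (evalMatrix (monomialFamily k N) z).mulVec (fun l => a (finSumFinEquiv l)) = 0}, φ z := by
  have hp : kacPolynomial n a ≠ 0 := fun h0 => by simpa [h0] using ha 0
  rw [sumDistinct_eq_tsum (nodup_roots_of_forall_eval_derivative_ne_zero ha)]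
  refine tsum_congr_set_coe φ (Set.ext fun z => and_congr
    det_toCols₁_evalMatrix_monomialFamily_ne_zero_iff.symm ?_)
  simp only [Polynomial.mem_roots hp, Polynomial.IsRoot, funext_iff,
    evalMatrix_monomialFamily_mulVec_apply hn, Pi.zero_apply]

end DistinctRoots

section KacPolynomialRoots

variable {Ω : Type*} [MeasurableSpace Ω] {P : Measure Ω} {G : ℕ → Ω → ℂ} {n k : ℕ}

theorem map_eq_pi_stdComplexGaussian {ι : Type*} [Fintype ι]
    (hlaw : ∀ i, HasLaw (G i) stdComplexGaussian P) (hindep : iIndepFun G P) {u : ι → ℕ}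
    (hu : Function.Injective u) :
    P.map (fun ω i => G (u i) ω) = Measure.pi fun _ => stdComplexGaussian := by
  rw [(hindep.precomp hu).map_fun_eq_pi_map fun i => (hlaw (u i)).aemeasurable]
  simp only [(hlaw _).map_eq]

theorem injective_finSumFinEquiv_val {k N : ℕ} :
    Function.Injective fun l : Fin k ⊕ Fin N => (finSumFinEquiv l : ℕ) :=
  Fin.val_injective.comp finSumFinEquiv.injective

theorem ae_forall_eval_derivative_kacPolynomial_ne_zero
    (hlaw : ∀ i, HasLaw (G i) stdComplexGaussian P) (hindep : iIndepFun G P) (n : ℕ) :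
    ∀ᵐ ω ∂P, ∀ w, (kacPolynomial n fun i => G i ω).eval w = 0 →
      (kacPolynomial n fun i => G i ω).derivative.eval w ≠ 0 := by
  have hsimple := ae_forall_evalMatrix_deriv_mulVec_ne_zero
    (differentiable_monomialFamily (k := 1) (N := n))
  have hac := withDensity_absolutelyContinuous (volume : Measure (Fin 1 ⊕ Fin n → ℂ))
    stdGaussianPDF
  rw [← pi_stdComplexGaussian,
    ← map_eq_pi_stdComplexGaussian hlaw hindep injective_finSumFinEquiv_val] at hac
  filter_upwards [ae_of_ae_map (aemeasurable_pi_lambda _ fun l => (hlaw _).aemeasurable)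
    (hac.ae_le hsimple)] with ω hω w hw
  have hzero := hω (fun _ => w)
    (det_toCols₁_evalMatrix_monomialFamily_ne_zero_iff.2 (Function.injective_of_subsingleton _))
    (funext fun i => (evalMatrix_monomialFamily_mulVec_apply (add_comm n 1) (fun i => G i ω) _
      i).trans hw) 0
  rwa [evalMatrix_deriv_monomialFamily_mulVec_apply (add_comm n 1) (fun i => G i ω)] at hzero

theorem lintegral_sumDistinct_roots_kacPolynomial
    (hlaw : ∀ i, HasLaw (G i) stdComplexGaussian P) (hindep : iIndepFun G P) (hn : k ≤ n + 1)
    {φ : (Fin k → ℂ) → ℝ≥0∞} (hφ : Measurable φ) :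
    ∫⁻ ω, sumDistinct k (kacPolynomial n fun i => G i ω).roots φ ∂P =
      ∫⁻ z, φ z * ENNReal.ofReal (kacIntensity (n + 1) z) := by
  obtain ⟨N, hN⟩ := Nat.exists_eq_add_of_le hn
  have hmap := map_eq_pi_stdComplexGaussian hlaw hindep (injective_finSumFinEquiv_val (k := k)
    (N := N))
  have hzeros := aemeasurable_tsum_zeros (differentiable_monomialFamily (k := k) (N := N)) hφ
  rw [← hmap] at hzeros
  rw [lintegral_congr_ae ((ae_forall_eval_derivative_kacPolynomial_ne_zero hlaw hindep n).mono
      fun ω hω => sumDistinct_roots_eq_tsum_zeros hN hω φ),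
    ← lintegral_map' hzeros (aemeasurable_pi_lambda _ fun l => (hlaw _).aemeasurable), hmap,
    lintegral_tsum_zeros differentiable_monomialFamily hφ]
  rw [← lintegral_indicator (measurableSet_det_toCols₁_evalMatrix_ne_zero
    fun l => (differentiable_monomialFamily l).continuous)]
  simp only [det_toCols₁_evalMatrix_monomialFamily_ne_zero_iff]
  refine lintegral_congr fun z => ?_
  by_cases hz : Function.Injective z
  · rw [Set.indicator_of_mem hz, gramZeroIntensity_monomialFamily hz, Complex.ofReal_re, hN]
  · rw [Set.indicator_of_notMem hz, kacIntensity_eq_zero hz, ENNReal.ofReal_zero, mul_zero]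

theorem isCorrelationFunction_kacIntensity
    (hlaw : ∀ i, HasLaw (G i) stdComplexGaussian P) (hindep : iIndepFun G P) (hn : k ≤ n + 1) :
    IsCorrelationFunction P (fun ω => (kacPolynomial n fun i => G i ω).roots) k
      (kacIntensity (n + 1)) where
  continuous := continuous_kacIntensity hn
  nonneg := kacIntensity_nonneg hn
  lintegral_eq _ := lintegral_sumDistinct_roots_kacPolynomial hlaw hindep hn

theorem card_roots_kacPolynomial_le (n : ℕ) (a : ℕ → ℂ) :
    Multiset.card (kacPolynomial n a).roots ≤ n :=
  (Polynomial.card_roots' _).trans <| Polynomial.natDegree_sum_le_of_forall_le _ _ fun _ hi =>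
    (Polynomial.natDegree_C_mul_X_pow_le _ _).trans (Finset.mem_range_succ_iff.1 hi)

theorem isCorrelationFunction_zero_of_card_lt {Z : Ω → Multiset ℂ}
    (hZ : ∀ ω, Multiset.card (Z ω) < k) : IsCorrelationFunction P Z k 0 where
  continuous := continuous_const
  nonneg _ := le_rfl
  lintegral_eq φ _ := by
    have hempty (ω : Ω) : IsEmpty (Fin k ↪ (Z ω).ToType) :=
      ⟨fun e => absurd (Fintype.card_le_of_embedding e) (by simpa using hZ ω)⟩
    simp [sumDistinct]

theorem exists_isCorrelationFunction_roots_kacPolynomial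
    (hlaw : ∀ i, HasLaw (G i) stdComplexGaussian P) (hindep : iIndepFun G P) (n k : ℕ) :
    ∃ ρ, IsCorrelationFunction P (fun ω => (kacPolynomial n fun i => G i ω).roots) k ρ := by
  rcases le_or_gt k (n + 1) with hn | hn
  · exact ⟨_, isCorrelationFunction_kacIntensity hlaw hindep hn⟩
  · exact ⟨0, isCorrelationFunction_zero_of_card_lt fun ω =>
      (card_roots_kacPolynomial_le n _).trans_lt (by omega)⟩

theorem isCorrelationFunction_unique {Z : Ω → Multiset ℂ} {ρ ρ' : (Fin k → ℂ) → ℝ}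
    (h : IsCorrelationFunction P Z k ρ) (h' : IsCorrelationFunction P Z k ρ') : ρ = ρ' := by
  have hset {σ : (Fin k → ℂ) → ℝ} (hσ : IsCorrelationFunction P Z k σ) {s : Set (Fin k → ℂ)}
      (hs : MeasurableSet s) : ∫⁻ z in s, ENNReal.ofReal (σ z) =
        ∫⁻ ω, sumDistinct k (Z ω) (s.indicator 1) ∂P := by
    rw [hσ.lintegral_eq _ (measurable_one.indicator hs), ← lintegral_indicator hs]
    refine lintegral_congr fun z => ?_
    by_cases hz : z ∈ s <;> simp [hz]
  rw [← h.continuous.ae_eq_iff_eq volume h'.continuous]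
  filter_upwards [ae_eq_of_forall_setLIntegral_eq_of_sigmaFinite
    h.continuous.measurable.ennreal_ofReal h'.continuous.measurable.ennreal_ofReal
    fun s hs _ => (hset h hs).trans (hset h' hs).symm] with z hz
  exact (ENNReal.ofReal_eq_ofReal_iff (h.nonneg z) (h'.nonneg z)).1 hz

end KacPolynomialRoots

theorem mainTheorem5 {Ω : Type*} [MeasurableSpace Ω] (P : Measure Ω) [IsProbabilityMeasure P]
    (G : ℕ → Ω → ℂ) (hlaw : ∀ i, HasLaw (G i) stdComplexGaussian P) (hindep : iIndepFun G P) :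
    (∀ n k : ℕ, ∃! ρ : (Fin k → ℂ) → ℝ,
      IsCorrelationFunction P (fun ω => (kacPolynomial n (fun i => G i ω)).roots) k ρ) ∧
    ∀ (k : ℕ) (ρ : ℕ → (Fin k → ℂ) → ℝ),
      (∀ n, IsCorrelationFunction P
        (fun ω => (kacPolynomial n (fun i => G i ω)).roots) k (ρ n)) →
      ∀ y : ℝ, y < 1 →
        TendstoUniformlyOn (fun n z => (ρ n z : ℂ)) (rhoInf k) atTop
          {z : Fin k → ℂ | ∀ i, ‖z i‖ ≤ y} := by
  refine ⟨fun n k => ?_, fun k ρ hρ y hy => ?_⟩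
  · obtain ⟨ρ, hρ⟩ := exists_isCorrelationFunction_roots_kacPolynomial hlaw hindep n k
    exact ⟨ρ, hρ, fun ρ' hρ' => isCorrelationFunction_unique hρ' hρ⟩
  · have hshift : TendstoUniformlyOn (fun n z => (kacIntensity (n + 1) z : ℂ)) (rhoInf k) atTop
        {z | ∀ i, ‖z i‖ ≤ y} :=
      fun u hu => (tendsto_add_atTop_nat 1).eventually (tendstoUniformlyOn_kacIntensity k hy u hu)
    refine hshift.congr ?_
    filter_upwards [eventually_ge_atTop k] with n hn z _
    rw [isCorrelationFunction_unique (hρ n)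
      (isCorrelationFunction_kacIntensity hlaw hindep (by omega))]
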